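/- Let $n\ge 2$, let $\mathbb K$ be a skew field and let $V$ be a vector space of dimension $n+1$ over $\mathbb K$, with projective space $\mathsf{PG}(n,\mathbb K)$ and associated building of type $\mathsf A_n$. An automorphism $\theta$ is a collineation (an inclusion-preserving permutation of the subspaces of $V$) or a duality (an inclusion-reversing one). The long root subgroup geometry has as points the incident point-hyperplane pairs $(p,H)$. Its lines are the sets $\{(p,H): p\in\ell\}$ with $H$ a hyperplane and $\ell\subseteq H$ a projective line, and the sets $\{(p,H): H\supseteq W\}$ with $p$ a point and $W\ni p$ a subspace of codimension $2$. A collineation maps $(p,H)$ to $(p^\theta,H^\theta)$, a duality maps it to $(H^\theta,p^\theta)$. Two points of this geometry are in position $0$ if they are equal; $1$ if they are distinct and collinear; $2$ if they are not collinear but lie in a common convex subspace that is a polar space of rank at least $2$; $2'$ if they are not collinear and exactly one point is collinear to both; $3$ if they are at distance $3$ in the collinearity graph. For $D\subseteq\{0,1,2,2',3\}$, $\theta$ is a polar $D$-kangaroo if for no point $x$ of this geometry the position of $x$ and $x^\theta$ belongs to $D$. Let $\delta(C,C')\in W=\mathrm{Sym}(n+1)$ be the Weyl distance of chambers (complete flags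 of subspaces), let $w_0$ be the longest element of $W$, and let $\sigma$ be the automorphism of $W$ induced by the companion automorphism of $\theta$: the identity for a collineation, conjugation by $w_0$ for a duality. Then $\theta$ is anisotropic if $\delta(C,C^\theta)=w_0$ for all chambers $C$, and uniclass if all $\delta(C,C^\theta)$ lie in a single $\sigma$-conjugacy class $\{g^{-1}v\,\sigma(g): g\in W\}$. A symplectic polarity is a duality that has order $2$ on the set of subspaces and for which every point is contained in its image. A line spread is a set of lines partitioning the set of points. **Theorem.** Let $\theta$ be a non-trivial automorphism of $\mathsf{PG}(n,\mathbb K)$, $n\ge2$. 1. $\theta$ is a polar $\{1,2'\}$-kangaroo if and only if it is anisotropic, or a symplectic polarity, or a collineation fixing every line of some line spread. 2. If $\theta$ is a symplectic polarity, then it is a polar $\{1,2',3\}$-kangaroo. 3. If $\theta$ is a collineation fixing every line of some line spread, then it is a polar $\{0,1,2'\}$-kangaroo. 4. $\theta$ is a polar $\{1,2'\}$-kangaroo if and only if it is uniclass. -/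

import Mathlib

/-! ### Point-line geometries -/

/-- A point-line geometry on the point set `X`; lines are sets of points. -/
structure PointLineGeometry (X : Type*) where
  lines : Set (Set X)

namespace PointLineGeometry

variable {X : Type*} (Γ : PointLineGeometry X)

/-- Two points are collinear if some line contains both (a point on a line is collinear to
itself). -/
def Collinear (x y : X) : Prop := ∃ L ∈ Γ.lines, x ∈ L ∧ y ∈ L

/-- The collinearity graph: distinct collinear points are adjacent. -/
def collinearityGraph : SimpleGraph X where
  Adj x y := x ≠ y ∧ Γ.Collinear x y
  symm := ⟨fun _ _ h => ⟨h.1.symm, h.2.imp fun _ hL => ⟨hL.1, hL.2.2, hL.2.1⟩⟩⟩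
  loopless := ⟨fun _ h => h.1 rfl⟩

/-- A subspace contains every line with which it shares two distinct points. -/
def IsSubspace (S : Set X) : Prop :=
  ∀ L ∈ Γ.lines, ∀ x ∈ L, ∀ y ∈ L, x ∈ S → y ∈ S → x ≠ y → L ⊆ S

/-- A convex subspace: it contains all points of every shortest path between two of its points. -/
def IsConvexSubspace (S : Set X) : Prop :=
  Γ.IsSubspace S ∧ ∀ x ∈ S, ∀ y ∈ S, ∀ w : Γ.collinearityGraph.Walk x y,
    w.length = Γ.collinearityGraph.dist x y → ∀ z ∈ w.support, z ∈ S

/-- A singular subspace: any two of its points are collinear. -/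
def IsSingularSubspace (S : Set X) : Prop :=
  Γ.IsSubspace S ∧ ∀ x ∈ S, ∀ y ∈ S, x ≠ y → Γ.Collinear x y

/-- The geometry induced on a set `S` of points: its lines are the lines contained in `S`. -/
def restrict (S : Set X) : PointLineGeometry S where
  lines := {M | ∃ L ∈ Γ.lines, L ⊆ S ∧ M = (Subtype.val ⁻¹' L : Set S)}

/-- A polar space of (finite) rank at least `2`: a partial linear space with at least one line and
with at least three points on each line, satisfying the one-or-all axiom, in which no point is
collinear to all other points and every nested family of singular subspaces is finite. -/
structure IsPolarSpaceOfRankAtLeastTwo : Prop where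
  exists_line : Γ.lines.Nonempty
  three_points : ∀ L ∈ Γ.lines, 3 ≤ L.encard
  partial_linear : ∀ L ∈ Γ.lines, ∀ M ∈ Γ.lines, ∀ x y : X,
    x ≠ y → x ∈ L → y ∈ L → x ∈ M → y ∈ M → L = M
  one_or_all : ∀ p : X, ∀ L ∈ Γ.lines,
    (∀ x ∈ L, Γ.Collinear p x) ∨ ∃! x, x ∈ L ∧ Γ.Collinear p x
  nondegenerate : ∀ p : X, ∃ q, q ≠ p ∧ ¬ Γ.Collinear p q
  finite_rank : ∀ c : Set (Set X), (∀ S ∈ c, Γ.IsSingularSubspace S) →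
    IsChain (· ⊆ ·) c → c.Finite

/-- The names of the possible mutual positions of two points in a long root subgroup geometry. -/
inductive Position
  | zero
  | one
  | two
  | twoPrime
  | three

/-- `Γ.InPosition d x y`: the points `x` and `y` are in mutual position `d`, i.e. respectively:
equal; distinct and collinear; symplectic (non-collinear, in a common convex subspace which is
a polar space of rank at least two); special (non-collinear with a unique point collinear to
both); at distance three in the collinearity graph. -/
def InPosition : Position → X → X → Prop
  | .zero, x, y => x = y
  | .one, x, y => x ≠ y ∧ Γ.Collinear x y
  | .two, x, y => x ≠ y ∧ ¬ Γ.Collinear x y ∧ ∃ S : Set X, x ∈ S ∧ y ∈ S ∧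
      Γ.IsConvexSubspace S ∧ (Γ.restrict S).IsPolarSpaceOfRankAtLeastTwo
  | .twoPrime, x, y => x ≠ y ∧ ¬ Γ.Collinear x y ∧ ∃! z, Γ.Collinear x z ∧ Γ.Collinear y z
  | .three, x, y => Γ.collinearityGraph.dist x y = 3

/-- A map skips the positions in `D` if no point is in a position from `D` with its image. -/
def IsKangaroo (D : Set Position) (f : X → X) : Prop :=
  ∀ x : X, ∀ d ∈ D, ¬ Γ.InPosition d x (f x)

end PointLineGeometry

/-! ### Projective spaces, their flags and their automorphisms -/

namespace ProjectiveGeometry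

variable (K V : Type*) [DivisionRing K] [AddCommGroup V] [Module K V]

/-- An incident point-hyperplane pair of the projective space of `V`. -/
@[ext]
structure PointHyperplaneFlag where
  point : Submodule K V
  hyperplane : Submodule K V
  isAtom : IsAtom point
  isCoatom : IsCoatom hyperplane
  le : point ≤ hyperplane

/-- The long root subgroup geometry of the projective space of `V`. Its points are the
point-hyperplane flags. There are two kinds of lines: a hyperplane `H` and a projective line `ℓ`
in `H` give the line of all `(p, H)` with `p` on `ℓ`; a point `p` and a subspace `W` of codimension
`2` through `p` give the line of all `(p, H)` with `H` through `W`. -/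
def longRootGeometry : PointLineGeometry (PointHyperplaneFlag K V) where
  lines := {S | (∃ ℓ H : Submodule K V, Module.finrank K ℓ = 2 ∧ IsCoatom H ∧ ℓ ≤ H ∧
        S = {x | x.hyperplane = H ∧ x.point ≤ ℓ}) ∨
      (∃ p W : Submodule K V, IsAtom p ∧ Module.finrank K (V ⧸ W) = 2 ∧ p ≤ W ∧
        S = {x | x.point = p ∧ W ≤ x.hyperplane})}

/-- An automorphism of the (building of the) projective space of `V`, through its action on
subspaces: either a collineation (preserving inclusion) or a duality (reversing inclusion). -/
inductive Aut
  | collineation (e : Submodule K V ≃o Submodule K V)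
  | duality (e : Submodule K V ≃o (Submodule K V)ᵒᵈ)

/-- A chamber of the building of a projective space of dimension `n`: a complete flag
`0 = C 0 < C 1 < ⋯ < C (n + 1) = V` of subspaces (when `V` has dimension `n + 1`, a strictly
increasing sequence of `n + 2` subspaces automatically satisfies `dim (C i) = i`). -/
structure Chamber (n : ℕ) where
  space : Fin (n + 2) → Submodule K V
  strictMono : StrictMono space

/-- A line spread: a set of projective lines partitioning the point set. -/
def IsLineSpread (S : Set (Submodule K V)) : Prop :=
  (∀ L ∈ S, Module.finrank K L = 2) ∧
    ∀ p : Submodule K V, IsAtom p → ∃! L, L ∈ S ∧ p ≤ L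

variable {K V}

/-! ### The Weyl distance -/

namespace Chamber

variable {n : ℕ}

theorem finrank_space (hV : Module.finrank K V = n + 1) (C : Chamber K V n) (i : Fin (n + 2)) :
    Module.finrank K (C.space i) = i := by
  have : FiniteDimensional K V := Module.finite_of_finrank_pos (by omega)
  have hmono : StrictMono fun i => Module.finrank K (C.space i) := fun i j h =>
    Submodule.finrank_lt_finrank_of_lt (C.strictMono h)
  have hle : ∀ i, Module.finrank K (C.space i) < n + 2 := fun i => by
    have := Submodule.finrank_le (C.space i); omega
  let f : Fin (n + 2) → Fin (n + 2) := fun i => ⟨_, hle i⟩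
  have hf : StrictMono f := fun i j h => hmono h
  have hid : f = id := by
    have := Subsingleton.elim (hf.orderIsoOfSurjective f
      (Finite.injective_iff_surjective.mp hf.injective)) (OrderIso.refl _)
    funext i
    exact congrArg (fun e : Fin (n + 2) ≃o Fin (n + 2) => e i) this
  exact congrArg Fin.val (congrFun hid i)

/-- The relative position of two complete flags: there is exactly one permutation `w` such that
`dim (C i ∩ D j)` is the number of `k < j` with `w k < i`. Equivalently, in some basis
`e 0, …, e n` one has `C i = ⟨e k | k < i⟩` and `D j = ⟨e (w k) | k < j⟩`. -/
theorem existsUnique_relativePosition (hV : Module.finrank K V = n + 1) (C D : Chamber K V n) :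
    ∃! w : Equiv.Perm (Fin (n + 1)), ∀ i j : Fin (n + 2),
      Module.finrank K ↥(C.space i ⊓ D.space j) =
        (Finset.univ.filter fun k : Fin (n + 1) =>
          (k : ℕ) < j ∧ ((w k : Fin (n + 1)) : ℕ) < i).card := by
  have : FiniteDimensional K V := Module.finite_of_finrank_pos (by omega)
  have hC := C.finrank_space hV
  have hD := D.finrank_space hV
  have hC0 : C.space 0 = ⊥ := Submodule.finrank_eq_zero.1 (by simpa using hC 0)
  have hD0 : D.space 0 = ⊥ := Submodule.finrank_eq_zero.1 (by simpa using hD 0)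
  have hCl : C.space (Fin.last _) = ⊤ :=
    Submodule.eq_top_of_finrank_eq (by rw [hC, hV]; simp)
  have step : ∀ (E : Chamber K V n) (k : Fin (n + 1)) (x y : V), x ∈ E.space k.succ →
      x ∉ E.space k.castSucc → y ∈ E.space k.succ → ∃ a : K, y - a • x ∈ E.space k.castSucc := by
    intro E k x y hx hx' hy
    have hlt : E.space k.castSucc < E.space k.castSucc ⊔ K ∙ x :=
      lt_of_le_of_ne le_sup_left fun h => hx' (by
        rw [h]; exact Submodule.mem_sup_right (Submodule.mem_span_singleton_self x))
    have hle : E.space k.castSucc ⊔ K ∙ x ≤ E.space k.succ :=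
      sup_le (E.strictMono.monotone k.castSucc_lt_succ.le) (by simpa using hx)
    have heq : E.space k.castSucc ⊔ K ∙ x = E.space k.succ := by
      refine Submodule.eq_of_le_of_finrank_le hle ?_
      have h1 := Submodule.finrank_lt_finrank_of_lt hlt
      have h2 := E.finrank_space hV k.castSucc
      have h3 := E.finrank_space hV k.succ
      simp only [Fin.val_castSucc, Fin.val_succ] at h2 h3
      omega
    rw [← heq] at hy
    obtain ⟨c, hc, z, hz, rfl⟩ := Submodule.mem_sup.1 hy
    obtain ⟨a, rfl⟩ := Submodule.mem_span_singleton.1 hz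
    exact ⟨a, by simpa using hc⟩
  have ex : ∀ k : Fin (n + 1), ∃ i : Fin (n + 1),
      C.space i.castSucc ⊓ D.space k.succ ≤ D.space k.castSucc ∧
      ¬ C.space i.succ ⊓ D.space k.succ ≤ D.space k.castSucc := by
    intro k
    by_contra! hcon
    have hall : ∀ i : Fin (n + 2), C.space i ⊓ D.space k.succ ≤ D.space k.castSucc := by
      intro i
      induction i using Fin.induction with
      | zero => rw [hC0]; simp
      | succ i ih => exact hcon i ih
    have := hall (Fin.last _)
    rw [hCl, top_inf_eq] at this
    exact absurd (D.strictMono k.castSucc_lt_succ) (not_lt_of_ge this)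
  choose f hf1 hf2 using ex
  have mono : ∀ i k, C.space i ⊓ D.space k.succ ≤ D.space k.castSucc ↔ i ≤ (f k).castSucc := by
    intro i k
    constructor
    · intro h
      by_contra hi
      have hi' : (f k).succ ≤ i := Fin.castSucc_lt_iff_succ_le.1 (not_le.1 hi)
      exact hf2 k ((inf_le_inf_right _ (C.strictMono.monotone hi')).trans h)
    · intro h
      exact (inf_le_inf_right _ (C.strictMono.monotone h)).trans (hf1 k)
  have key : ∀ k l : Fin (n + 1), k < l → f k ≠ f l := by
    intro k l hkl h
    obtain ⟨x, ⟨hxC, hxD⟩, hx⟩ := SetLike.not_le_iff_exists.1 (hf2 k)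
    obtain ⟨y, ⟨hyC, hyD⟩, hy⟩ := SetLike.not_le_iff_exists.1 (hf2 l)
    rw [← h] at hyC
    have hx' : x ∉ C.space (f k).castSucc := fun hxc => hx (hf1 k ⟨hxc, hxD⟩)
    obtain ⟨a, ha⟩ := step C (f k) x y hxC hx' hyC
    have hxl : x ∈ D.space l.castSucc :=
      D.strictMono.monotone (show k.succ ≤ l.castSucc from Fin.succ_le_castSucc_iff.2 hkl) hxD
    have hxl' := D.strictMono.monotone l.castSucc_lt_succ.le hxl
    have hz : y - a • x ∈ D.space l.castSucc :=
      hf1 l ⟨h ▸ ha, Submodule.sub_mem _ hyD (Submodule.smul_mem _ _ hxl')⟩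
    exact hy (by simpa using Submodule.add_mem _ hz (Submodule.smul_mem _ a hxl))
  have finj : Function.Injective f := fun k l h => by
    rcases lt_trichotomy k l with hkl | hkl | hkl
    · exact absurd h (key k l hkl)
    · exact hkl
    · exact absurd h.symm (key l k hkl)
  let w : Equiv.Perm (Fin (n + 1)) :=
    Equiv.ofBijective f (Finite.injective_iff_bijective.1 finj)
  have hw : ∀ k, w k = f k := fun _ => rfl
  have cnt : ∀ (v : Equiv.Perm (Fin (n + 1))) (i : Fin (n + 2)) (j : Fin (n + 1)),
      (Finset.univ.filter fun k : Fin (n + 1) =>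
        (k : ℕ) < j.succ ∧ ((v k : Fin (n + 1)) : ℕ) < i).card =
      (Finset.univ.filter fun k : Fin (n + 1) =>
        (k : ℕ) < j.castSucc ∧ ((v k : Fin (n + 1)) : ℕ) < i).card +
        if ((v j : Fin (n + 1)) : ℕ) < i then 1 else 0 := by
    intro v i j
    split_ifs with h
    · rw [← Finset.card_insert_of_notMem (a := j) (by simp)]
      congr 1
      ext k
      simp only [Finset.mem_filter, Finset.mem_univ, true_and, Finset.mem_insert, Fin.val_succ,
        Fin.val_castSucc, Fin.ext_iff]
      constructor
      · rintro ⟨h1, h2⟩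
        by_cases hk : (k : ℕ) = j
        · exact Or.inl hk
        · exact Or.inr ⟨by omega, h2⟩
      · rintro (hk | ⟨h1, h2⟩)
        · obtain rfl := Fin.ext hk
          exact ⟨by omega, h⟩
        · exact ⟨by omega, h2⟩
    · rw [add_zero]
      congr 1
      ext k
      simp only [Finset.mem_filter, Finset.mem_univ, true_and, Fin.val_succ, Fin.val_castSucc]
      constructor
      · rintro ⟨h1, h2⟩
        refine ⟨lt_of_le_of_ne (by omega) fun hk => ?_, h2⟩
        obtain rfl := Fin.ext hk
        exact h h2
      · rintro ⟨h1, h2⟩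
        exact ⟨by omega, h2⟩
  refine ⟨w, ?_, ?_⟩
  · intro i j
    induction j using Fin.induction with
    | zero => rw [hD0, inf_bot_eq]; simp
    | succ j ih =>
      rw [cnt, ← ih, hw]
      have hsub : C.space i ⊓ D.space j.castSucc ≤ C.space i ⊓ D.space j.succ :=
        inf_le_inf_left _ (D.strictMono.monotone j.castSucc_lt_succ.le)
      split_ifs with h
      · have hnot : ¬ C.space i ⊓ D.space j.succ ≤ D.space j.castSucc := by
          rw [mono, not_le, Fin.lt_def]; exact h
        obtain ⟨x, ⟨hxC, hxD⟩, hx⟩ := SetLike.not_le_iff_exists.1 hnot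
        have hlt : C.space i ⊓ D.space j.castSucc < C.space i ⊓ D.space j.succ :=
          lt_of_le_of_ne hsub fun he => hnot (he ▸ inf_le_right)
        have h1 := Submodule.finrank_lt_finrank_of_lt hlt
        have hle : C.space i ⊓ D.space j.succ ≤ (C.space i ⊓ D.space j.castSucc) ⊔ K ∙ x := by
          rintro y ⟨hyC, hyD⟩
          obtain ⟨a, ha⟩ := step D j x y hxD hx hyD
          refine Submodule.mem_sup.2 ⟨y - a • x, ⟨?_, ha⟩, a • x,
            Submodule.mem_span_singleton.2 ⟨a, rfl⟩, by simp⟩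
          exact Submodule.sub_mem _ hyC (Submodule.smul_mem _ _ hxC)
        have h2 := (Submodule.finrank_mono hle).trans
          (Submodule.finrank_add_le_finrank_add_finrank _ _)
        have h3 := finrank_span_singleton (K := K) (v := x)
          (fun h0 => hx (h0 ▸ Submodule.zero_mem _))
        omega
      · have hyes : C.space i ⊓ D.space j.succ ≤ D.space j.castSucc := by
          rw [mono, Fin.le_def]; exact not_lt.1 h
        rw [add_zero, le_antisymm (le_inf inf_le_left hyes) hsub]
  · intro v hv
    have hvw : ∀ (j : Fin (n + 1)) (i : Fin (n + 2)),
        ((v j : Fin (n + 1)) : ℕ) < i ↔ ¬ C.space i ⊓ D.space j.succ ≤ D.space j.castSucc := by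
      intro j i
      have h1 := cnt v i j
      rw [← hv, ← hv] at h1
      have hsub : C.space i ⊓ D.space j.castSucc ≤ C.space i ⊓ D.space j.succ :=
        inf_le_inf_left _ (D.strictMono.monotone j.castSucc_lt_succ.le)
      split_ifs at h1 with h
      · refine iff_of_true h fun hle => ?_
        rw [le_antisymm (le_inf inf_le_left hle) hsub] at h1
        omega
      · refine iff_of_false h fun hle => hle ?_
        rw [← Submodule.eq_of_le_of_finrank_eq hsub (by omega)]
        exact inf_le_right
    ext j
    have a1 := hvw j (w j).castSucc
    have a2 := hvw j (w j).succ
    rw [mono, not_le, hw, Fin.lt_def] at a1 a2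
    simp only [Fin.val_castSucc, Fin.val_succ] at a1 a2
    have := hw j
    rw [this]
    omega

/-- The Weyl distance `δ(C, D)`, in the Weyl group of type `A_n`, i.e. the symmetric group on
`n + 1` letters with the adjacent transpositions as Coxeter generators. -/
noncomputable def weylDist (hV : Module.finrank K V = n + 1) (C D : Chamber K V n) :
    Equiv.Perm (Fin (n + 1)) :=
  (existsUnique_relativePosition hV C D).choose

end Chamber

/-! ### The action of automorphisms -/

namespace Aut

/-- The permutation of the set of all subspaces induced by an automorphism. -/
def onSubspaces : Aut K V → Equiv.Perm (Submodule K V)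
  | .collineation e => e.toEquiv
  | .duality e => e.toEquiv.trans OrderDual.ofDual

/-- The action on point-hyperplane flags: `(p, H) ↦ (p^θ, H^θ)` for a collineation `θ`, and
`(p, H) ↦ (H^θ, p^θ)` for a duality `θ`. -/
def onFlags : Aut K V → PointHyperplaneFlag K V → PointHyperplaneFlag K V
  | .collineation e, x =>
    { point := e x.point
      hyperplane := e x.hyperplane
      isAtom := (e.isAtom_iff _).2 x.isAtom
      isCoatom := (e.isCoatom_iff _).2 x.isCoatom
      le := e.monotone x.le }
  | .duality e, x =>
    { point := OrderDual.ofDual (e x.hyperplane)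
      hyperplane := OrderDual.ofDual (e x.point)
      isAtom := isCoatom_dual_iff_isAtom.1 ((e.isCoatom_iff _).2 x.isCoatom)
      isCoatom := isAtom_dual_iff_isCoatom.1 ((e.isAtom_iff _).2 x.isAtom)
      le := e.monotone x.le }

variable {n : ℕ}

/-- The action on chambers. -/
def onChambers : Aut K V → Chamber K V n → Chamber K V n
  | .collineation e, C =>
    { space := fun i => e (C.space i)
      strictMono := fun _ _ h => e.strictMono (C.strictMono h) }
  | .duality e, C =>
    { space := fun i => OrderDual.ofDual (e (C.space i.rev))
      strictMono := fun _ _ h => e.strictMono (C.strictMono (Fin.rev_lt_rev.2 h)) }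

/-- The automorphism `σ` of the Weyl group induced by the companion automorphism of the Coxeter
diagram: trivial for a collineation; for a duality it is `s_i ↦ s_{n+1-i}`, which is
conjugation by the longest element `Fin.revPerm`. -/
def companion (n : ℕ) : Aut K V → MulAut (Equiv.Perm (Fin (n + 1)))
  | .collineation _ => 1
  | .duality _ => MulAut.conj Fin.revPerm

/-- The displacement spectrum: the set of all `δ(C, C^θ)`. -/
def displacement (hV : Module.finrank K V = n + 1) (θ : Aut K V) :
    Set (Equiv.Perm (Fin (n + 1))) :=
  Set.range fun C : Chamber K V n => C.weylDist hV (θ.onChambers C)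

/-- Uniclass: the displacement spectrum is contained in a single `σ`-conjugacy class
`{g⁻¹ v σ(g)}`. -/
def IsUniclass (hV : Module.finrank K V = n + 1) (θ : Aut K V) : Prop :=
  ∃ v : Equiv.Perm (Fin (n + 1)), ∀ w ∈ θ.displacement hV,
    ∃ g : Equiv.Perm (Fin (n + 1)), w = g⁻¹ * v * θ.companion n g

/-- Anisotropic: every chamber is mapped to an opposite chamber, i.e. `δ(C, C^θ)` is always the
longest element of the Weyl group. -/
def IsAnisotropic (hV : Module.finrank K V = n + 1) (θ : Aut K V) : Prop :=
  ∀ C : Chamber K V n, C.weylDist hV (θ.onChambers C) = Fin.revPerm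

/-- A symplectic polarity: a duality of order two on the set of subspaces such that every point
is contained in its image. -/
def IsSymplecticPolarity (θ : Aut K V) : Prop :=
  (∃ e, θ = .duality e) ∧ orderOf θ.onSubspaces = 2 ∧
    ∀ p : Submodule K V, IsAtom p → p ≤ θ.onSubspaces p

/-- A collineation fixing every line of some line spread. -/
def IsCollineationFixingLineSpread (θ : Aut K V) : Prop :=
  (∃ e, θ = .collineation e) ∧
    ∃ S : Set (Submodule K V), IsLineSpread K V S ∧ ∀ L ∈ S, θ.onSubspaces L = L

/-- A polar `D`-kangaroo: the action on the long root subgroup geometry skips all mutual positions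
in `D`. -/
def IsPolarKangaroo (D : Set PointLineGeometry.Position) (θ : Aut K V) : Prop :=
  (longRootGeometry K V).IsKangaroo D θ.onFlags

end Aut

end ProjectiveGeometry

/-!
The proof rests on a description of the kangaroo condition in terms of flags, and on the sign of the
Weyl distance.

*Positions.* Distinct flags `(p, H)` and `(p', H')` are collinear exactly if `p = p'` or `H = H'`,
and otherwise their only possible common neighbours are `(p, H')` and `(p', H)`. So `θ` skips the
positions `1` and `2'` if and only if for every flag `x = (p, H)` with image `(p', H')` one has
`p = p' ↔ H = H'` and `p ≤ H' ↔ p' ≤ H` (`Aut.isPolarKangaroo_one_twoPrime_iff`).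

*Kangaroos.* For a nontrivial collineation `e`, this condition says that no point is fixed and that
the line joining a point to its image is always fixed (`MovesPointsAlongFixedLines`); these lines
form a spread, and conversely every nontrivial collineation fixing the lines of a spread has this
property. For a duality, the condition gives that either all points are absolute, and then the
duality is a symplectic polarity (`isSymplecticPolarity_of_forall_le_dualImage`), or none is, and
then it is anisotropic (`isAnisotropic_of_forall_not_le_dualImage`).

*Kangaroos are uniclass.* If `e` moves points along fixed lines, `δ(C, Cᶿ)` is always a fixed point
free involution; for a symplectic polarity, `δ(C, Cᶿ) w₀` is. All such involutions are conjugate.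

*Uniclass automorphisms are kangaroos.* The sign of a permutation is constant on twisted conjugacy
classes, so the displacements of a uniclass automorphism have constant sign
(`Aut.IsUniclass.sign_eq`). Only pairs of chambers that differ just in their points need to be
compared: if `D` and `D'` have the same line `ℓ` and the point of `D` is the one where `C` first
meets `ℓ`, then `δ(C, D)` and `δ(C, D')` have different signs
(`Chamber.sign_weylDist_of_adjacent`). For a collineation, this shows that a fixed line with one
fixed point is fixed pointwise, and that the line joining a moved point to its image is fixed;
together these leave no room for a fixed point. For a duality, it shows that the image of an
absolute point contains all nonabsolute points, which is impossible if both kinds of points exist.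
-/

namespace ProjectiveGeometry

open Module

variable {K V : Type*} [DivisionRing K] [AddCommGroup V] [Module K V]

/-! ### Points, lines and hyperplanes -/

section Subspaces

variable {p q r U W H ℓ : Submodule K V}

theorem finrank_atom (hp : IsAtom p) : finrank K p = 1 :=
  Submodule.isAtom_iff_finrank_eq_one.1 hp

theorem eq_of_atom_le_atom (hp : IsAtom p) (hq : IsAtom q) (h : p ≤ q) : p = q :=
  (hq.le_iff.1 h).resolve_left hp.1

theorem inf_eq_bot_of_atom_not_le (hp : IsAtom p) (h : ¬ p ≤ U) : p ⊓ U = ⊥ :=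
  (hp.le_iff.1 inf_le_left).resolve_right fun he => h (he ▸ inf_le_right)

theorem exists_atom_le_not_le (h : ¬ U ≤ W) : ∃ p, IsAtom p ∧ p ≤ U ∧ ¬ p ≤ W := by
  by_contra! hcon
  exact h (le_iff_atom_le_imp.2 hcon)

theorem exists_third_atom (hp : IsAtom p) (hq : IsAtom q) (h : p ≠ q) :
    ∃ r, IsAtom r ∧ r ≤ p ⊔ q ∧ r ≠ p ∧ r ≠ q := by
  obtain ⟨x, hx, hx0⟩ := Submodule.exists_mem_ne_zero_of_ne_bot hp.1
  obtain ⟨y, hy, hy0⟩ := Submodule.exists_mem_ne_zero_of_ne_bot hq.1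
  have hdis : p ⊓ q = ⊥ :=
    inf_eq_bot_of_atom_not_le hp fun hle => h (eq_of_atom_le_atom hp hq hle)
  have hxq : x ∉ q := fun hxq => hx0 ((Submodule.mem_bot K).1 (hdis ▸ ⟨hx, hxq⟩))
  have hyp : y ∉ p := fun hyp => hy0 ((Submodule.mem_bot K).1 (hdis ▸ ⟨hyp, hy⟩))
  have hmem := Submodule.mem_span_singleton_self (R := K) (x + y)
  have hne : x + y ≠ 0 := fun h0 => hyp (by
    rw [eq_neg_of_add_eq_zero_right h0]; exact p.neg_mem hx)
  refine ⟨K ∙ (x + y), nonzero_span_atom _ hne, ?_, ?_, ?_⟩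
  · rw [Submodule.span_singleton_le_iff_mem]
    exact Submodule.add_mem_sup hx hy
  · intro he
    rw [he] at hmem
    exact hyp ((Submodule.add_mem_iff_right p hx).1 hmem)
  · intro he
    rw [he] at hmem
    exact hxq ((Submodule.add_mem_iff_left q hy).1 hmem)

theorem le_of_forall_coatom (h : ∀ H, IsCoatom H → W ≤ H → U ≤ H) : U ≤ W := by
  by_contra hne
  obtain ⟨p, hp, hpU, hpW⟩ := exists_atom_le_not_le hne
  have hdis : Disjoint W p := disjoint_iff.2 (inf_comm W p ▸ inf_eq_bot_of_atom_not_le hp hpW)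
  obtain ⟨H, hWH, hc⟩ := hdis.exists_isCompl
  have hH : IsCoatom H := hc.isCoatom_iff_isAtom.2 hp
  exact hp.1 (hc.disjoint.eq_bot_of_ge (hpU.trans (h H hH hWH)))

variable [FiniteDimensional K V]

theorem finrank_sup_atom (hp : IsAtom p) (h : ¬ p ≤ U) :
    finrank K ↥(U ⊔ p) = finrank K U + 1 := by
  have h1 := Submodule.finrank_sup_add_finrank_inf_eq U p
  rw [inf_comm, inf_eq_bot_of_atom_not_le hp h, finrank_bot, finrank_atom hp] at h1
  omega

theorem finrank_atom_sup_atom (hp : IsAtom p) (hq : IsAtom q) (h : p ≠ q) :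
    finrank K ↥(p ⊔ q) = 2 := by
  rw [finrank_sup_atom hq fun hle => h (eq_of_atom_le_atom hq hp hle).symm, finrank_atom hp]

theorem sup_eq_of_finrank_two (hℓ : finrank K ℓ = 2) (hp : IsAtom p) (hq : IsAtom q)
    (h : p ≠ q) (hpℓ : p ≤ ℓ) (hqℓ : q ≤ ℓ) : p ⊔ q = ℓ :=
  Submodule.eq_of_le_of_finrank_eq (sup_le hpℓ hqℓ) (by rw [finrank_atom_sup_atom hp hq h, hℓ])

/-- A point `r ≠ q` of the line `p ⊔ q` spans this line together with `q`. -/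
theorem atom_exchange (hp : IsAtom p) (hq : IsAtom q) (hr : IsAtom r) (hpq : p ≠ q) (hrq : r ≠ q)
    (h : r ≤ p ⊔ q) : p ≤ r ⊔ q := by
  rw [sup_eq_of_finrank_two (finrank_atom_sup_atom hp hq hpq) hr hq hrq h le_sup_right]
  exact le_sup_left

/-- A subspace meeting a line in at least the point `p`, but not containing it, meets it in `p`. -/
theorem inf_eq_atom_of_finrank_two (hℓ : finrank K ℓ = 2) (hp : IsAtom p) (hpℓ : p ≤ ℓ)
    (hpU : p ≤ U) (h : ¬ ℓ ≤ U) : ℓ ⊓ U = p := by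
  have h1 : finrank K ↥(ℓ ⊓ U) < 2 := hℓ ▸ Submodule.finrank_lt_finrank_of_lt
    (lt_of_le_of_ne inf_le_left fun he => h (he ▸ inf_le_right))
  refine (Submodule.eq_of_le_of_finrank_le (le_inf hpℓ hpU) ?_).symm
  rw [finrank_atom hp]; omega

theorem finrank_coatom (hH : IsCoatom H) : finrank K H + 1 = finrank K V := by
  obtain ⟨p, hp⟩ := exists_isCompl H
  have h1 := Submodule.finrank_add_eq_of_isCompl hp
  rwa [finrank_atom (hp.isCoatom_iff_isAtom.1 hH)] at h1

theorem finrank_inf_coatom (hH : IsCoatom H) (h : ¬ U ≤ H) :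
    finrank K ↥(U ⊓ H) + 1 = finrank K U := by
  have h1 := Submodule.finrank_sup_add_finrank_inf_eq U H
  have h2 : U ⊔ H = ⊤ := hH.2 _ (lt_of_le_of_ne le_sup_right fun he => h (he ▸ le_sup_left))
  rw [h2, finrank_top, ← finrank_coatom hH] at h1
  omega

end Subspaces

/-! ### Chambers through prescribed subspaces -/

variable {n : ℕ}

theorem exists_succ_comparable [FiniteDimensional K V] {A B U : Submodule K V} (hAB : A ≤ B)
    (hA : U ≤ A ∨ A ≤ U) (hB : U ≤ B ∨ B ≤ U) (hU : U ≠ ⊤) :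
    ∃ U', U ≤ U' ∧ finrank K U' = finrank K U + 1 ∧ (U' ≤ A ∨ A ≤ U') ∧ (U' ≤ B ∨ B ≤ U') := by
  -- The new subspace is chosen inside the first of `A`, `B`, `⊤` that is not yet contained in `U`.
  have key : ∀ T, ¬ T ≤ U → ∃ U', U ≤ U' ∧ finrank K U' = finrank K U + 1 ∧ (U ≤ T → U' ≤ T) := by
    intro T hT
    obtain ⟨p, hp, hpT, hpU⟩ := exists_atom_le_not_le hT
    exact ⟨U ⊔ p, le_sup_left, finrank_sup_atom hp hpU, fun h => sup_le h hpT⟩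
  by_cases h1 : A ≤ U
  · by_cases h2 : B ≤ U
    · obtain ⟨U', h, h', -⟩ := key ⊤ fun h => hU (top_le_iff.1 h)
      exact ⟨U', h, h', Or.inr (h1.trans h), Or.inr (h2.trans h)⟩
    · obtain ⟨U', h, h', h''⟩ := key B h2
      exact ⟨U', h, h', Or.inr (h1.trans h), Or.inl (h'' (hB.resolve_right h2))⟩
  · obtain ⟨U', h, h', h''⟩ := key A h1
    have := h'' (hA.resolve_right h1)
    exact ⟨U', h, h', Or.inl this, Or.inl (this.trans hAB)⟩

/-- The conclusion determines the member of the chamber by its dimension, so it says that the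
chamber contains `A` and `B`. -/
theorem exists_chamber_through (hV : finrank K V = n + 1) {A B : Submodule K V} (hAB : A ≤ B) :
    ∃ C : Chamber K V n, (∀ i : Fin (n + 2), (i : ℕ) = finrank K A → C.space i = A) ∧
      ∀ i : Fin (n + 2), (i : ℕ) = finrank K B → C.space i = B := by
  have : FiniteDimensional K V := Module.finite_of_finrank_pos (by omega)
  have step : ∀ U : Submodule K V, ∃ U', U ≠ ⊤ → (U ≤ A ∨ A ≤ U) → (U ≤ B ∨ B ≤ U) →
      U ≤ U' ∧ finrank K U' = finrank K U + 1 ∧ (U' ≤ A ∨ A ≤ U') ∧ (U' ≤ B ∨ B ≤ U') := by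
    intro U
    by_cases h : U ≠ ⊤ ∧ (U ≤ A ∨ A ≤ U) ∧ (U ≤ B ∨ B ≤ U)
    · exact (exists_succ_comparable hAB h.2.1 h.2.2 h.1).imp fun _ h _ _ _ => h
    · exact ⟨⊤, fun h1 h2 h3 => absurd ⟨h1, h2, h3⟩ h⟩
  choose g hg using step
  let c : ℕ → Submodule K V := fun i => g^[i] ⊥
  have hc1 : ∀ i, c (i + 1) = g (c i) := fun i => Function.iterate_succ_apply' g i ⊥
  have hc : ∀ i ≤ n + 1, finrank K (c i) = i ∧ (c i ≤ A ∨ A ≤ c i) ∧ (c i ≤ B ∨ B ≤ c i) := by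
    intro i
    induction i with
    | zero => exact fun _ => ⟨finrank_bot K V, Or.inl bot_le, Or.inl bot_le⟩
    | succ i ih =>
      intro hi
      obtain ⟨h1, h2, h3⟩ := ih (by omega)
      have hne : c i ≠ ⊤ := fun h => by rw [h, finrank_top] at h1; omega
      rw [hc1]
      obtain ⟨-, h4, h5⟩ := hg _ hne h2 h3
      exact ⟨by rw [h4, h1], h5⟩
  have hlt : ∀ i < n + 1, c i < c (i + 1) := by
    intro i hi
    obtain ⟨h1, h2, h3⟩ := hc i (by omega)
    have hne : c i ≠ ⊤ := fun h => by rw [h, finrank_top] at h1; omega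
    obtain ⟨h4, h5, -⟩ := hg _ hne h2 h3
    rw [hc1]
    exact lt_of_le_of_ne h4 fun h => by rw [← h] at h5; omega
  have heq : ∀ (T : Submodule K V) (i : Fin (n + 2)), (c i ≤ T ∨ T ≤ c i) →
      (i : ℕ) = finrank K T → c i = T := by
    intro T i h hi
    have h1 := (hc i (by omega)).1
    rcases h with h | h
    · exact Submodule.eq_of_le_of_finrank_eq h (h1.trans hi)
    · exact (Submodule.eq_of_le_of_finrank_eq h (h1.trans hi).symm).symm
  refine ⟨⟨fun i => c i, Fin.strictMono_iff_lt_succ.2 fun i => ?_⟩, fun i => ?_, fun i => ?_⟩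
  · simpa using hlt i (by omega)
  · exact heq A i (hc i (by omega)).2.1
  · exact heq B i (hc i (by omega)).2.2

theorem exists_between_finrank (hV : finrank K V = n + 1) {A B : Submodule K V} (hAB : A ≤ B)
    {m : ℕ} (hA : finrank K A ≤ m) (hB : m ≤ finrank K B) :
    ∃ U, A ≤ U ∧ U ≤ B ∧ finrank K U = m := by
  have : FiniteDimensional K V := Module.finite_of_finrank_pos (by omega)
  have hBV := Submodule.finrank_le B
  obtain ⟨C, hCA, hCB⟩ := exists_chamber_through hV hAB
  refine ⟨C.space ⟨m, by omega⟩, ?_, ?_, C.finrank_space hV _⟩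
  · rw [← hCA ⟨finrank K A, by omega⟩ rfl]
    exact C.strictMono.monotone hA
  · exact (C.strictMono.monotone (Fin.le_def.2 hB)).trans_eq (hCB ⟨finrank K B, by omega⟩ rfl)

theorem Chamber.space_eq_bot (hV : finrank K V = n + 1) (C : Chamber K V n) {i : Fin (n + 2)}
    (hi : (i : ℕ) = 0) : C.space i = ⊥ := by
  have : FiniteDimensional K V := Module.finite_of_finrank_pos (by omega)
  exact Submodule.finrank_eq_zero.1 ((C.finrank_space hV i).trans hi)

theorem Chamber.space_eq_top (hV : finrank K V = n + 1) (C : Chamber K V n) {i : Fin (n + 2)}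
    (hi : (i : ℕ) = n + 1) : C.space i = ⊤ := by
  have : FiniteDimensional K V := Module.finite_of_finrank_pos (by omega)
  exact Submodule.eq_top_of_finrank_eq ((C.finrank_space hV i).trans (hi.trans hV.symm))

/-- Through every line `r ⊔ t` there are two chambers differing only in their points, which are
`r` and `t`. -/
theorem exists_adjacent_chambers (hn : 2 ≤ n) (hV : finrank K V = n + 1) {r t : Submodule K V}
    (hr : IsAtom r) (ht : IsAtom t) (hrt : r ≠ t) :
    ∃ C C' : Chamber K V n, (∀ i : Fin (n + 2), (i : ℕ) ≠ 1 → C'.space i = C.space i) ∧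
      (∀ i : Fin (n + 2), (i : ℕ) = 1 → C.space i = r ∧ C'.space i = t) ∧
      ∀ i : Fin (n + 2), (i : ℕ) = 2 → C.space i = r ⊔ t := by
  have : FiniteDimensional K V := Module.finite_of_finrank_pos (by omega)
  have h2 := finrank_atom_sup_atom hr ht hrt
  obtain ⟨C, hCr, hCl⟩ := exists_chamber_through hV (le_sup_left : r ≤ r ⊔ t)
  rw [finrank_atom hr] at hCr
  rw [h2] at hCl
  have hlt : t < r ⊔ t := lt_of_le_of_ne le_sup_right fun h => by
    rw [← h, finrank_atom ht] at h2; omega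
  have hmono : StrictMono fun i : Fin (n + 2) => if (i : ℕ) = 1 then t else C.space i := by
    intro i j hij
    rw [Fin.lt_def] at hij
    dsimp only
    split_ifs with hi hj hj
    · omega
    · refine hlt.trans_le ?_
      rw [← hCl ⟨2, by omega⟩ rfl]
      exact C.strictMono.monotone (Fin.le_def.2 (show 2 ≤ (j : ℕ) by omega))
    · rw [C.space_eq_bot hV (by omega)]
      exact ht.bot_lt
    · exact C.strictMono hij
  refine ⟨C, ⟨_, hmono⟩, fun i hi => if_neg hi, fun i hi => ⟨hCr i hi, if_pos hi⟩, hCl⟩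

/-! ### Permutations and their corner counts -/

/-- The number of `k < j` with `w k < i`; the relative position `w` of two complete flags `C`, `D`
is characterized by `dim (C i ∩ D j) = cornerCount w i j`. -/
def cornerCount (w : Equiv.Perm (Fin (n + 1))) (i j : ℕ) : ℕ :=
  (Finset.univ.filter fun k : Fin (n + 1) => (k : ℕ) < j ∧ ((w k : Fin (n + 1)) : ℕ) < i).card

theorem cornerCount_inv (w : Equiv.Perm (Fin (n + 1))) (i j : ℕ) :
    cornerCount w⁻¹ i j = cornerCount w j i := by
  refine Finset.card_equiv w⁻¹ fun k => ?_
  simp [and_comm]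

theorem cornerCount_zero (w : Equiv.Perm (Fin (n + 1))) (i : ℕ) : cornerCount w i 0 = 0 := by
  simp [cornerCount]

theorem cornerCount_succ (w : Equiv.Perm (Fin (n + 1))) (i : ℕ) (k : Fin (n + 1)) :
    cornerCount w i (k + 1) = cornerCount w i k + if (w k : ℕ) < i then 1 else 0 := by
  have hsplit : (Finset.univ.filter fun l : Fin (n + 1) => (l : ℕ) < k + 1 ∧ (w l : ℕ) < i) =
      (Finset.univ.filter fun l : Fin (n + 1) => (l : ℕ) < k ∧ (w l : ℕ) < i) ∪
        if (w k : ℕ) < i then {k} else ∅ := by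
    ext l
    by_cases hl : l = k
    · subst hl
      by_cases h : (w l : ℕ) < i <;> simp [h]
    · have hl' : (l : ℕ) ≠ k := fun h => hl (Fin.ext h)
      have : l ≤ k ↔ l < k := by rw [Fin.le_def, Fin.lt_def]; omega
      by_cases h : (w k : ℕ) < i <;> simp [h, hl, this]
  unfold cornerCount
  rw [hsplit, Finset.card_union_of_disjoint]
  · split_ifs <;> simp
  · split_ifs <;> simp

theorem cornerCount_revPerm {i j : ℕ} (hi : i ≤ n + 1) (hj : j ≤ n + 1) :
    cornerCount (Fin.revPerm : Equiv.Perm (Fin (n + 1))) i j = i + j - (n + 1) := by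
  induction j with
  | zero => rw [cornerCount_zero]; omega
  | succ j ih =>
    have h := cornerCount_succ (Fin.revPerm : Equiv.Perm (Fin (n + 1))) i ⟨j, by omega⟩
    simp only [Fin.revPerm_apply, Fin.val_rev] at h
    rw [h, ih (by omega)]
    split_ifs <;> omega

/-- Composing with the first generator only changes the column `j = 1`, where the new count is
`cornerCount w i 2 - cornerCount w i 1`. -/
theorem cornerCount_mul_swap {a b : Fin (n + 1)} (ha : (a : ℕ) = 0) (hb : (b : ℕ) = 1)
    (w : Equiv.Perm (Fin (n + 1))) (i j : ℕ) :
    cornerCount (w * Equiv.swap a b) i j + (if j = 1 then cornerCount w i 1 else 0) =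
      if j = 1 then cornerCount w i 2 else cornerCount w i j := by
  split_ifs with hj
  · subst hj
    have h1 := cornerCount_succ (w * Equiv.swap a b) i a
    have h2 := cornerCount_succ w i a
    have h3 := cornerCount_succ w i b
    simp only [ha, hb, zero_add, Nat.reduceAdd, cornerCount_zero, Equiv.Perm.mul_apply,
      Equiv.swap_apply_left] at h1 h2 h3
    omega
  · rw [add_zero]
    refine Finset.card_equiv (Equiv.swap a b) fun k => ?_
    rw [Finset.mem_filter, Finset.mem_filter]
    simp only [Finset.mem_univ, true_and, Equiv.Perm.mul_apply]
    by_cases hka : k = a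
    · rw [hka, Equiv.swap_apply_left]; omega
    · by_cases hkb : k = b
      · rw [hkb, Equiv.swap_apply_right]; omega
      · rw [Equiv.swap_apply_of_ne_of_ne hka hkb]

/-- The substitution `m = w⁻¹ (rev k)` turns the left-hand count into that of the `m ≥ n + 1 - i`
with `w m ≥ n + 1 - j`. -/
theorem cornerCount_revPerm_mul_inv_mul_revPerm (w : Equiv.Perm (Fin (n + 1))) {i j : ℕ}
    (hi : i ≤ n + 1) (hj : j ≤ n + 1) :
    cornerCount (Fin.revPerm * w⁻¹ * Fin.revPerm) i j + (n + 1) =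
      i + j + cornerCount w (n + 1 - j) (n + 1 - i) := by
  have hval : ∀ m a, a ≤ n + 1 →
      (Finset.univ.filter fun k : Fin (n + 1) => ((m : Equiv.Perm (Fin (n + 1))) k : ℕ) < a).card
        = a := by
    intro m a ha
    have : (Finset.univ.filter fun k : Fin (n + 1) => (k : ℕ) < a).card = a := by
      rw [Fin.card_filter_val_lt]; omega
    exact Eq.trans (Finset.card_equiv m fun k => by simp) this
  have h1 : cornerCount (Fin.revPerm * w⁻¹ * Fin.revPerm) i j =
      (Finset.univ.filter fun m : Fin (n + 1) =>
        ¬ (w m : ℕ) < n + 1 - j ∧ ¬ (m : ℕ) < n + 1 - i).card := by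
    refine Finset.card_equiv (Fin.revPerm.trans w⁻¹) fun k => ?_
    have hw : w (w⁻¹ k.rev) = k.rev := w.apply_symm_apply _
    simp only [Finset.mem_filter, Finset.mem_univ, true_and, Equiv.Perm.mul_apply,
      Equiv.trans_apply, Fin.revPerm_apply, Fin.val_rev, hw]
    omega
  have h2 := Finset.card_filter_add_card_filter_not (s := Finset.univ)
    (fun m : Fin (n + 1) => (w m : ℕ) < n + 1 - j)
  have h3 := Finset.card_filter_add_card_filter_not
    (s := Finset.univ.filter fun m : Fin (n + 1) => ¬ (w m : ℕ) < n + 1 - j)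
    (fun m : Fin (n + 1) => (m : ℕ) < n + 1 - i)
  have h4 := Finset.card_filter_add_card_filter_not
    (s := Finset.univ.filter fun m : Fin (n + 1) => (m : ℕ) < n + 1 - i)
    (fun m : Fin (n + 1) => (w m : ℕ) < n + 1 - j)
  have h5 := hval w (n + 1 - j) (by omega)
  have h6 : (Finset.univ.filter fun m : Fin (n + 1) => (m : ℕ) < n + 1 - i).card = n + 1 - i :=
    hval 1 (n + 1 - i) (by omega)
  rw [Finset.filter_filter, Finset.filter_filter] at h3 h4
  rw [Finset.card_univ, Fintype.card_fin] at h2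
  rw [h1]
  unfold cornerCount
  simp only [and_comm (a := ¬ (w _ : ℕ) < n + 1 - j) (b := (_ : ℕ) < n + 1 - i)] at h3
  omega

/-- Any two fixed point free involutions of a finite set are conjugate. -/
theorem isConj_of_fixedPointFree_involutions {α : Type*} [Fintype α] [DecidableEq α]
    {u v : Equiv.Perm α} (hu : u ^ 2 = 1) (hv : v ^ 2 = 1) (hu' : ∀ a, u a ≠ a)
    (hv' : ∀ a, v a ≠ a) : IsConj u v := by
  rw [Equiv.Perm.isConj_iff_cycleType_eq, Equiv.Perm.cycleType_of_pow_prime_eq_one hu,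
    Equiv.Perm.cycleType_of_pow_prime_eq_one hv]
  have h1 := u.sum_cycleType
  have h2 := v.sum_cycleType
  have : u.support = v.support := by ext; simp [hu', hv']
  rw [Equiv.Perm.cycleType_of_pow_prime_eq_one hu, this, Multiset.sum_replicate] at h1
  rw [Equiv.Perm.cycleType_of_pow_prime_eq_one hv, Multiset.sum_replicate, ← h1] at h2
  rw [Nat.eq_of_mul_eq_mul_right two_pos h2]

/-! ### The Weyl distance -/

namespace Chamber

theorem finrank_inf_eq_cornerCount (hV : finrank K V = n + 1) (C D : Chamber K V n)
    (i j : Fin (n + 2)) :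
    finrank K ↥(C.space i ⊓ D.space j) = cornerCount (C.weylDist hV D) i j :=
  (existsUnique_relativePosition hV C D).choose_spec.1 i j

theorem weylDist_eq_of_finrank (hV : finrank K V = n + 1) {C D : Chamber K V n}
    {w : Equiv.Perm (Fin (n + 1))}
    (h : ∀ i j : Fin (n + 2), finrank K ↥(C.space i ⊓ D.space j) = cornerCount w i j) :
    C.weylDist hV D = w :=
  ((existsUnique_relativePosition hV C D).choose_spec.2 w h).symm

theorem weylDist_congr (hV : finrank K V = n + 1) {C D C' D' : Chamber K V n}
    (h : ∀ i j : Fin (n + 2), finrank K ↥(C.space i ⊓ D.space j) =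
      finrank K ↥(C'.space i ⊓ D'.space j)) : C.weylDist hV D = C'.weylDist hV D' :=
  weylDist_eq_of_finrank hV fun i j => (h i j).trans (finrank_inf_eq_cornerCount hV C' D' i j)

theorem weylDist_swap (hV : finrank K V = n + 1) (C D : Chamber K V n) :
    D.weylDist hV C = (C.weylDist hV D)⁻¹ :=
  weylDist_eq_of_finrank hV fun i j => by
    rw [cornerCount_inv, inf_comm, finrank_inf_eq_cornerCount hV C D]

theorem weylDist_apply_lt_iff (hV : finrank K V = n + 1) (C D : Chamber K V n) (k : Fin (n + 1))
    (i : Fin (n + 2)) : (C.weylDist hV D k : ℕ) < i ↔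
      ¬ C.space i ⊓ D.space k.succ ≤ D.space k.castSucc := by
  have : FiniteDimensional K V := Module.finite_of_finrank_pos (by omega)
  have h1 := cornerCount_succ (C.weylDist hV D) i k
  have h2 := finrank_inf_eq_cornerCount hV C D i k.succ
  have h3 := finrank_inf_eq_cornerCount hV C D i k.castSucc
  rw [Fin.val_succ] at h2
  rw [Fin.val_castSucc] at h3
  rw [← h2, ← h3] at h1
  have hsub : C.space i ⊓ D.space k.castSucc ≤ C.space i ⊓ D.space k.succ :=
    inf_le_inf_left _ (D.strictMono.monotone k.castSucc_lt_succ.le)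
  split_ifs at h1 with h
  · refine iff_of_true h fun hle => ?_
    rw [le_antisymm (le_inf inf_le_left hle) hsub] at h1
    omega
  · refine iff_of_false h fun hle => hle ?_
    rw [← Submodule.eq_of_le_of_finrank_eq hsub (by omega)]
    exact inf_le_right

/-- Let `D` and `D'` be chambers with the same line and different points. If the point of `D` is
in every member of `C` that meets this line, then the point of `D'` is further from `C`, and the
two Weyl distances differ by the first generator. -/
theorem sign_weylDist_of_adjacent (hn : 2 ≤ n) (hV : finrank K V = n + 1) {C D D' : Chamber K V n}
    (hne : ∀ i : Fin (n + 2), (i : ℕ) ≠ 1 → D'.space i = D.space i)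
    (h1 : ∀ i : Fin (n + 2), (i : ℕ) = 1 → D'.space i ≠ D.space i)
    (hfirst : ∀ i a b : Fin (n + 2), (a : ℕ) = 1 → (b : ℕ) = 2 →
      C.space i ⊓ D.space b ≠ ⊥ → D.space a ≤ C.space i) :
    Equiv.Perm.sign (C.weylDist hV D') = - Equiv.Perm.sign (C.weylDist hV D) := by
  have : FiniteDimensional K V := Module.finite_of_finrank_pos (by omega)
  have hw : C.weylDist hV D' =
      C.weylDist hV D * Equiv.swap ⟨0, by omega⟩ ⟨1, by omega⟩ := by
    refine weylDist_eq_of_finrank hV fun i j => ?_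
    have hs := cornerCount_mul_swap (a := ⟨0, by omega⟩) (b := ⟨1, by omega⟩) rfl rfl
      (C.weylDist hV D) i j
    by_cases hj : (j : ℕ) = 1
    · rw [if_pos hj, if_pos hj] at hs
      let b : Fin (n + 2) := ⟨2, by omega⟩
      have e1 := finrank_inf_eq_cornerCount hV C D i j
      have e2 := finrank_inf_eq_cornerCount hV C D i b
      rw [hj] at e1
      rw [show (b : ℕ) = 2 from rfl] at e2
      rw [← e1, ← e2] at hs
      suffices h : finrank K ↥(C.space i ⊓ D'.space j) + finrank K ↥(C.space i ⊓ D.space j) =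
          finrank K ↥(C.space i ⊓ D.space b) by omega
      have hb : finrank K (D.space b) = 2 := D.finrank_space hV b
      have hp : IsAtom (D.space j) :=
        Submodule.isAtom_iff_finrank_eq_one.2 ((D.finrank_space hV j).trans hj)
      have hp' : IsAtom (D'.space j) :=
        Submodule.isAtom_iff_finrank_eq_one.2 ((D'.finrank_space hV j).trans hj)
      have hjb : j ≤ b := Fin.le_def.2 (by rw [hj]; exact Nat.le_succ 1)
      have hpb : D.space j ≤ D.space b := D.strictMono.monotone hjb
      have hpb' : D'.space j ≤ D.space b := by
        rw [← hne b (by simp [b])]; exact D'.strictMono.monotone hjb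
      have hsup := sup_eq_of_finrank_two hb hp' hp (h1 j hj) hpb' hpb
      by_cases hbot : C.space i ⊓ D.space b = ⊥
      · have e3 : C.space i ⊓ D.space j = ⊥ :=
          le_bot_iff.1 (hbot ▸ inf_le_inf_left _ hpb)
        have e4 : C.space i ⊓ D'.space j = ⊥ :=
          le_bot_iff.1 (hbot ▸ inf_le_inf_left _ hpb')
        rw [hbot, e3, e4, finrank_bot]
      · have hle := hfirst i j b hj rfl hbot
        by_cases hle' : D'.space j ≤ C.space i
        · have hbC : D.space b ≤ C.space i := hsup ▸ sup_le hle' hle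
          rw [inf_eq_right.2 hle', inf_eq_right.2 hle, inf_eq_right.2 hbC, finrank_atom hp,
            finrank_atom hp', hb]
        · have hbC : ¬ D.space b ≤ C.space i := fun h => hle' (hpb'.trans h)
          rw [inf_comm (C.space i) (D'.space j), inf_eq_bot_of_atom_not_le hp' hle',
            inf_eq_right.2 hle, inf_comm, inf_eq_atom_of_finrank_two hb hp hpb hle hbC,
            finrank_bot, zero_add]
    · rw [if_neg hj, if_neg hj, add_zero] at hs
      rw [hs, hne j hj, finrank_inf_eq_cornerCount hV C D]
  rw [hw, map_mul, Equiv.Perm.sign_swap (by simp [Fin.ext_iff])]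
  simp

end Chamber

/-- The displacements of a uniclass automorphism all have the same sign, as the sign is constant
on twisted conjugacy classes. -/
theorem Aut.IsUniclass.sign_eq {hV : finrank K V = n + 1} {θ : Aut K V} (h : θ.IsUniclass hV)
    (C C' : Chamber K V n) :
    Equiv.Perm.sign (C.weylDist hV (θ.onChambers C)) =
      Equiv.Perm.sign (C'.weylDist hV (θ.onChambers C')) := by
  obtain ⟨v, hv⟩ := h
  have hσ : ∀ g, Equiv.Perm.sign (θ.companion n g) = Equiv.Perm.sign g := by
    intro g
    cases θ with
    | collineation e => rfl
    | duality e => 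
      rw [companion, MulAut.conj_apply, map_mul, map_mul, Equiv.Perm.sign_inv,
        mul_right_comm, Int.units_mul_self, one_mul]
  have key : ∀ C : Chamber K V n,
      Equiv.Perm.sign (C.weylDist hV (θ.onChambers C)) = Equiv.Perm.sign v := by
    intro C
    obtain ⟨g, hg⟩ := hv _ ⟨C, rfl⟩
    rw [show C.weylDist hV (θ.onChambers C) = _ from hg, map_mul, map_mul, hσ, Equiv.Perm.sign_inv,
      mul_comm, ← mul_assoc, Int.units_mul_self, one_mul]
  rw [key, key]

/-! ### Mutual positions in the long root subgroup geometry -/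

theorem longRootGeometry_collinear_iff (hn : 2 ≤ n) (hV : finrank K V = n + 1)
    {x y : PointHyperplaneFlag K V} : (longRootGeometry K V).Collinear x y ↔
      x.point = y.point ∨ x.hyperplane = y.hyperplane := by
  have : FiniteDimensional K V := Module.finite_of_finrank_pos (by omega)
  constructor
  · rintro ⟨L, ⟨ℓ, H, -, -, -, rfl⟩ | ⟨p, W, -, -, -, rfl⟩, hx, hy⟩
    · exact Or.inr (hx.1.trans hy.1.symm)
    · exact Or.inl (hx.1.trans hy.1.symm)
  · have hHx := finrank_coatom x.isCoatom
    have hHy := finrank_coatom y.isCoatom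
    have hpx := finrank_atom x.isAtom
    have hpy := finrank_atom y.isAtom
    rintro (h | h)
    · have h1 := Submodule.finrank_sup_add_finrank_inf_eq x.hyperplane y.hyperplane
      have h2 := Submodule.finrank_le (x.hyperplane ⊔ y.hyperplane)
      obtain ⟨W, hpW, hW, hW'⟩ := exists_between_finrank hV (m := n - 1)
        (le_inf x.le (h.le.trans y.le)) (by omega) (by omega)
      refine ⟨_, Or.inr ⟨x.point, W, x.isAtom, ?_, hpW, rfl⟩, ⟨rfl, hW.trans inf_le_left⟩,
        ⟨h.symm, hW.trans inf_le_right⟩⟩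
      have h3 := W.finrank_quotient_add_finrank
      omega
    · have h1 := Submodule.finrank_add_le_finrank_add_finrank x.point y.point
      obtain ⟨ℓ, hpℓ, hℓ, hℓ'⟩ := exists_between_finrank hV (m := 2)
        (sup_le x.le (y.le.trans h.ge)) (by omega) (by omega)
      exact ⟨_, Or.inl ⟨ℓ, x.hyperplane, hℓ', x.isCoatom, hℓ, rfl⟩,
        ⟨rfl, le_sup_left.trans hpℓ⟩, ⟨h.symm, le_sup_right.trans hpℓ⟩⟩

/-- Two flags `(p, H)`, `(p', H')` with `p ≠ p'` and `H ≠ H'` can only have the common neighbours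
`(p, H')` and `(p', H)`, and these are flags exactly when `p ≤ H'`, respectively `p' ≤ H`. -/
theorem not_inPosition_one_twoPrime_iff (hn : 2 ≤ n) (hV : finrank K V = n + 1)
    {x y : PointHyperplaneFlag K V} :
    (∀ d ∈ ({.one, .twoPrime} : Set PointLineGeometry.Position),
      ¬ (longRootGeometry K V).InPosition d x y) ↔
      (x.point = y.point ↔ x.hyperplane = y.hyperplane) ∧
        (x.point ≤ y.hyperplane ↔ y.point ≤ x.hyperplane) := by
  simp only [Set.mem_insert_iff, Set.mem_singleton_iff, forall_eq_or_imp, forall_eq,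
    PointLineGeometry.InPosition, longRootGeometry_collinear_iff hn hV]
  by_cases hp : x.point = y.point
  · by_cases hH : x.hyperplane = y.hyperplane
    · simp [PointHyperplaneFlag.ext hp hH, y.le]
    · have hxy : x ≠ y := fun h => hH (congrArg _ h)
      simp [hp, hH, hxy]
  · have hxy : x ≠ y := fun h => hp (congrArg _ h)
    by_cases hH : x.hyperplane = y.hyperplane
    · simp [hp, hH, hxy]
    · simp only [hp, hH, hxy, or_self, not_false_eq_true, ne_eq, and_false, true_and, iff_self]
      let z₁ (h : x.point ≤ y.hyperplane) : PointHyperplaneFlag K V :=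
        ⟨x.point, y.hyperplane, x.isAtom, y.isCoatom, h⟩
      let z₂ (h : y.point ≤ x.hyperplane) : PointHyperplaneFlag K V :=
        ⟨y.point, x.hyperplane, y.isAtom, x.isCoatom, h⟩
      have hz : ∀ z : PointHyperplaneFlag K V,
          ((x.point = z.point ∨ x.hyperplane = z.hyperplane) ∧
            (y.point = z.point ∨ y.hyperplane = z.hyperplane)) ↔
          (z.point = x.point ∧ z.hyperplane = y.hyperplane) ∨
            (z.point = y.point ∧ z.hyperplane = x.hyperplane) := by
        intro z
        constructor
        · rintro ⟨h1 | h1, h2 | h2⟩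
          · exact absurd (h1.trans h2.symm) hp
          · exact Or.inl ⟨h1.symm, h2.symm⟩
          · exact Or.inr ⟨h2.symm, h1.symm⟩
          · exact absurd (h1.trans h2.symm) hH
        · rintro (⟨h1, h2⟩ | ⟨h1, h2⟩)
          · exact ⟨Or.inl h1.symm, Or.inr h2.symm⟩
          · exact ⟨Or.inr h2.symm, Or.inl h1.symm⟩
      simp only [hz]
      constructor
      · intro hno
        by_contra hne
        rcases not_iff.1 hne with hne
        by_cases h : x.point ≤ y.hyperplane
        · refine hno ⟨z₁ h, Or.inl ⟨rfl, rfl⟩, ?_⟩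
          rintro z (⟨h1, h2⟩ | ⟨h1, h2⟩)
          · exact PointHyperplaneFlag.ext h1 h2
          · exact absurd h (hne.2 (h1 ▸ h2 ▸ z.le))
        · have h' := hne.1 h
          refine hno ⟨z₂ h', Or.inr ⟨rfl, rfl⟩, ?_⟩
          rintro z (⟨h1, h2⟩ | ⟨h1, h2⟩)
          · exact absurd (h1 ▸ h2 ▸ z.le) h
          · exact PointHyperplaneFlag.ext h1 h2
      · rintro hiff ⟨z, hz1, huniq⟩
        have h : x.point ≤ y.hyperplane := by
          rcases hz1 with ⟨h1, h2⟩ | ⟨h1, h2⟩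
          · exact h1 ▸ h2 ▸ z.le
          · exact hiff.2 (h1 ▸ h2 ▸ z.le)
        have e1 := huniq (z₁ h) (Or.inl ⟨rfl, rfl⟩)
        have e2 := huniq (z₂ (hiff.1 h)) (Or.inr ⟨rfl, rfl⟩)
        exact hp ((congrArg PointHyperplaneFlag.point (e1.trans e2.symm) :))

theorem Aut.isPolarKangaroo_one_twoPrime_iff (hn : 2 ≤ n) (hV : finrank K V = n + 1)
    {θ : Aut K V} : θ.IsPolarKangaroo {.one, .twoPrime} ↔ ∀ x : PointHyperplaneFlag K V,
      (x.point = (θ.onFlags x).point ↔ x.hyperplane = (θ.onFlags x).hyperplane) ∧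
        (x.point ≤ (θ.onFlags x).hyperplane ↔ (θ.onFlags x).point ≤ x.hyperplane) :=
  forall_congr' fun _ => not_inPosition_one_twoPrime_iff hn hV

theorem not_inPosition_three (hn : 2 ≤ n) (hV : finrank K V = n + 1)
    {x y : PointHyperplaneFlag K V} (hxy : x.point ≤ y.hyperplane) :
    ¬ (longRootGeometry K V).InPosition .three x y := by
  let z : PointHyperplaneFlag K V := ⟨x.point, y.hyperplane, x.isAtom, y.isCoatom, hxy⟩
  have key : ∀ {u v : PointHyperplaneFlag K V}, (longRootGeometry K V).Collinear u v →
      ∃ w : (longRootGeometry K V).collinearityGraph.Walk u v, w.length ≤ 1 := by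
    intro u v h
    by_cases huv : u = v
    · subst huv
      exact ⟨.nil, by simp⟩
    · have hadj : (longRootGeometry K V).collinearityGraph.Adj u v := ⟨huv, h⟩
      exact ⟨.cons hadj .nil, by simp⟩
  obtain ⟨w₁, h₁⟩ := key ((longRootGeometry_collinear_iff hn hV (x := x) (y := z)).2 (Or.inl rfl))
  obtain ⟨w₂, h₂⟩ := key ((longRootGeometry_collinear_iff hn hV (x := z) (y := y)).2 (Or.inr rfl))
  intro h
  have hd : (longRootGeometry K V).collinearityGraph.dist x y = 3 := h
  have := SimpleGraph.dist_le (w₁.append w₂)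
  rw [SimpleGraph.Walk.length_append] at this
  omega

/-! ### Anisotropic automorphisms -/

/-- A point and a hyperplane of a chamber are opposite their images: `p` is not in `H'` and `p'` is
not in `H`. -/
theorem Aut.IsAnisotropic.isPolarKangaroo (hn : 2 ≤ n) {hV : finrank K V = n + 1} {θ : Aut K V}
    (h : θ.IsAnisotropic hV) : θ.IsPolarKangaroo {.one, .twoPrime} := by
  have : FiniteDimensional K V := Module.finite_of_finrank_pos (by omega)
  rw [isPolarKangaroo_one_twoPrime_iff hn hV]
  intro x
  obtain ⟨C, hCp, hCH⟩ := exists_chamber_through hV x.le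
  let a : Fin (n + 2) := ⟨1, by omega⟩
  let b : Fin (n + 2) := ⟨n, by omega⟩
  have hp : C.space a = x.point := hCp a (finrank_atom x.isAtom).symm
  have hH : C.space b = x.hyperplane := hCH b (by have := finrank_coatom x.isCoatom; simp [b]; omega)
  have hra : a.rev = b := by ext; simp [a, b, Fin.val_rev]
  have hrb : b.rev = a := by ext; simp [a, b, Fin.val_rev]
  have hp' : (θ.onChambers C).space a = (θ.onFlags x).point := by
    cases θ with
    | collineation e => exact congrArg e hp
    | duality e => exact congrArg (fun U => OrderDual.ofDual (e U)) (by rw [hra, hH])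
  have hH' : (θ.onChambers C).space b = (θ.onFlags x).hyperplane := by
    cases θ with
    | collineation e => exact congrArg e hH
    | duality e => exact congrArg (fun U => OrderDual.ofDual (e U)) (by rw [hrb, hp])
  have h1 := Chamber.finrank_inf_eq_cornerCount hV C (θ.onChambers C) a b
  have h2 := Chamber.finrank_inf_eq_cornerCount hV C (θ.onChambers C) b a
  rw [h C, cornerCount_revPerm (by omega) (by omega)] at h1 h2
  rw [hp, hH', show (a : ℕ) + b - (n + 1) = 0 by simp [a, b]; omega,
    Submodule.finrank_eq_zero] at h1
  rw [hH, hp', show (b : ℕ) + a - (n + 1) = 0 by simp [a, b], Submodule.finrank_eq_zero] at h2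
  have n1 : ¬ x.point ≤ (θ.onFlags x).hyperplane := fun hle =>
    x.isAtom.1 (inf_eq_left.2 hle ▸ h1)
  have n2 : ¬ (θ.onFlags x).point ≤ x.hyperplane := fun hle =>
    (θ.onFlags x).isAtom.1 (inf_eq_right.2 hle ▸ h2)
  exact ⟨iff_of_false (fun he => n1 (he ▸ (θ.onFlags x).le)) fun he => n1 (he ▸ x.le),
    iff_of_false n1 n2⟩

/-! ### Collineations moving every point along a fixed line -/

/-- The image of a chamber through `U` is a chamber through `e U`. -/
theorem finrank_orderIso (hV : finrank K V = n + 1) (e : Submodule K V ≃o Submodule K V)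
    (U : Submodule K V) : finrank K (e U) = finrank K U := by
  have : FiniteDimensional K V := Module.finite_of_finrank_pos (by omega)
  obtain ⟨C, hC, -⟩ := exists_chamber_through hV (le_refl U)
  have hU := Submodule.finrank_le U
  let i : Fin (n + 2) := ⟨finrank K U, by omega⟩
  have h := ((Aut.collineation e).onChambers C).finrank_space hV i
  rwa [show ((Aut.collineation e).onChambers C).space i = e U from congrArg e (hC i rfl)] at h

theorem collineation_onSubspaces_eq_one {e : Submodule K V ≃o Submodule K V}
    (h : ∀ p, IsAtom p → e p = p) : (Aut.collineation e).onSubspaces = 1 := by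
  refine Equiv.ext fun U => ?_
  refine eq_iff_atom_le_iff.2 fun p hp => ?_
  change p ≤ e U ↔ p ≤ U
  conv_lhs => rw [← h p hp, e.le_iff_le]

/-- The collineation `e` has no fixed points, and the line joining any point to its image is
fixed. -/
def MovesPointsAlongFixedLines (e : Submodule K V ≃o Submodule K V) : Prop :=
  ∀ p, IsAtom p → e p ≠ p ∧ e (p ⊔ e p) = p ⊔ e p

section Spreads

variable {e : Submodule K V ≃o Submodule K V} {p U W : Submodule K V}

theorem isAtom_orderIso (e : Submodule K V ≃o Submodule K V) (hp : IsAtom p) : IsAtom (e p) :=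
  (e.isAtom_iff p).2 hp

/-- The points `p`, `e p` and the preimage of `p` are on one line, so a subspace through `p` that
contains one of the other two contains both. -/
theorem MovesPointsAlongFixedLines.le_apply_iff
    (h : MovesPointsAlongFixedLines e) (hp : IsAtom p) (hpW : p ≤ W) : p ≤ e W ↔ e p ≤ W := by
  constructor
  · intro hle
    obtain ⟨hne, hfix⟩ := h _ (isAtom_orderIso e.symm hp)
    rw [e.apply_symm_apply] at hne hfix
    have h1 : e.symm p ⊔ p ≤ W := sup_le (e.symm_apply_le.2 hle) hpW
    exact (e.monotone le_sup_right).trans (hfix.le.trans h1)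
  · intro hle
    have h1 := e.monotone (sup_le hpW hle)
    rw [(h p hp).2] at h1
    exact le_sup_left.trans h1

theorem MovesPointsAlongFixedLines.finrank_join [FiniteDimensional K V]
    (h : MovesPointsAlongFixedLines e) (hp : IsAtom p) : finrank K ↥(p ⊔ e p) = 2 :=
  finrank_atom_sup_atom hp (isAtom_orderIso e hp) (h p hp).1.symm

theorem MovesPointsAlongFixedLines.join_eq [FiniteDimensional K V]
    (h : MovesPointsAlongFixedLines e) {q : Submodule K V} (hp : IsAtom p) (hq : IsAtom q)
    (hqp : q ≤ p ⊔ e p) : q ⊔ e q = p ⊔ e p :=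
  sup_eq_of_finrank_two (h.finrank_join hp) hq (isAtom_orderIso e hq) (h q hq).1.symm hqp
    ((e.monotone hqp).trans (h p hp).2.le)

theorem MovesPointsAlongFixedLines.apply_hyperplane_ne [FiniteDimensional K V]
    (h : MovesPointsAlongFixedLines e) {H : Submodule K V} (hH : IsCoatom H) : e H ≠ H := by
  intro he
  obtain ⟨q, hq, -, hqH⟩ := exists_atom_le_not_le fun hle => hH.1 (top_le_iff.1 hle)
  have h1 := finrank_inf_coatom hH fun hle : q ⊔ e q ≤ H => hqH (le_sup_left.trans hle)
  rw [h.finrank_join hq] at h1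
  have hx : IsAtom ((q ⊔ e q) ⊓ H) := Submodule.isAtom_iff_finrank_eq_one.2 (by omega)
  exact (h _ hx).1 (by rw [map_inf, (h q hq).2, he])

theorem MovesPointsAlongFixedLines.isCollineationFixingLineSpread [FiniteDimensional K V]
    (h : MovesPointsAlongFixedLines e) : (Aut.collineation e).IsCollineationFixingLineSpread := by
  refine ⟨⟨e, rfl⟩, {L | ∃ p, IsAtom p ∧ L = p ⊔ e p}, ⟨?_, fun p hp => ?_⟩, ?_⟩
  · rintro _ ⟨p, hp, rfl⟩
    exact h.finrank_join hp
  · refine ⟨p ⊔ e p, ⟨⟨p, hp, rfl⟩, le_sup_left⟩, ?_⟩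
    rintro _ ⟨⟨q, hq, rfl⟩, hpq⟩
    exact (h.join_eq hq hp hpq).symm
  · rintro _ ⟨p, hp, rfl⟩
    exact (h p hp).2

/-- If a collineation fixes the lines of a spread and the point `p`, it fixes all points on the
spread lines not through `p`: for a point `y` on such a line `m`, a further point `r` on the line
`p ⊔ y` is the intersection of its spread line with the fixed plane `p ⊔ m`, so `r`, hence the line
`p ⊔ y` and the point `y` are fixed. -/
theorem apply_eq_of_lineSpread [FiniteDimensional K V] {S : Set (Submodule K V)}
    (hS : IsLineSpread K V S) (hfix : ∀ L ∈ S, e L = L) (hp : IsAtom p) (hep : e p = p)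
    {m y : Submodule K V} (hm : m ∈ S) (hpm : ¬ p ≤ m) (hy : IsAtom y) (hym : y ≤ m) :
    e y = y := by
  have hpy : p ≠ y := fun he => hpm (he ▸ hym)
  obtain ⟨r, hr, hrpy, hrp, hry⟩ := exists_third_atom hp hy hpy
  obtain ⟨k, ⟨hk, hrk⟩, -⟩ := hS.2 r hr
  have hpry : p ≤ r ⊔ y := atom_exchange hp hy hr hpy hry hrpy
  have hrm : ¬ r ≤ m := fun hle => hpm (hpry.trans (sup_le hle hym))
  have hkm : m ⊓ k = ⊥ := by
    by_contra hne
    obtain ⟨z, hz, hzle⟩ := (eq_bot_or_exists_atom_le (m ⊓ k)).resolve_left hne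
    have := (hS.2 z hz).unique ⟨hm, hzle.trans inf_le_left⟩ ⟨hk, hzle.trans inf_le_right⟩
    exact hrm (this ▸ hrk)
  have hk2 := hS.1 k hk
  have hm2 := hS.1 m hm
  have hπ := finrank_sup_atom hp hpm
  have hknot : ¬ k ≤ m ⊔ p := by
    intro hle
    have h1 := Submodule.finrank_sup_add_finrank_inf_eq m k
    rw [hkm, finrank_bot] at h1
    have h2 := Submodule.finrank_mono (sup_le le_sup_left hle : m ⊔ k ≤ m ⊔ p)
    omega
  have hrπ : r ≤ m ⊔ p := hrpy.trans (sup_le le_sup_right (hym.trans le_sup_left))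
  have her : e r = r := by
    conv_lhs => rw [← inf_eq_atom_of_finrank_two hk2 hr hrk hrπ hknot, map_inf, map_sup,
      hfix k hk, hfix m hm, hep]
    exact inf_eq_atom_of_finrank_two hk2 hr hrk hrπ hknot
  have hyrp : y ≤ r ⊔ p := by
    rw [sup_comm] at hrpy
    exact atom_exchange hy hp hr hpy.symm hrp hrpy
  have hmnot : ¬ m ≤ r ⊔ p := fun hle => by
    have h3 := Submodule.eq_of_le_of_finrank_eq hle (by
      rw [hm2, finrank_atom_sup_atom hr hp hrp])
    exact hrm (h3 ▸ le_sup_left)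
  conv_lhs => rw [← inf_eq_atom_of_finrank_two hm2 hy hym hyrp hmnot, map_inf, map_sup,
    hfix m hm, her, hep]
  exact inf_eq_atom_of_finrank_two hm2 hy hym hyrp hmnot

theorem movesPointsAlongFixedLines_of_lineSpread (hn : 2 ≤ n) (hV : finrank K V = n + 1)
    {S : Set (Submodule K V)} (hS : IsLineSpread K V S) (hfix : ∀ L ∈ S, e L = L)
    (hne : (Aut.collineation e).onSubspaces ≠ 1) : MovesPointsAlongFixedLines e := by
  have : FiniteDimensional K V := Module.finite_of_finrank_pos (by omega)
  have hmove : ∀ p, IsAtom p → e p ≠ p := by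
    intro p hp hep
    refine hne (collineation_onSubspaces_eq_one fun z hz => ?_)
    obtain ⟨k, ⟨hk, hzk⟩, -⟩ := hS.2 z hz
    by_cases hpk : p ≤ k
    · -- The points of `k` are fixed because those of another spread line `m` are.
      have hktop : ¬ (⊤ : Submodule K V) ≤ k := fun hle => by
        have h1 := Submodule.finrank_mono hle
        rw [finrank_top, hS.1 k hk] at h1
        omega
      obtain ⟨y, hy, -, hyk⟩ := exists_atom_le_not_le hktop
      obtain ⟨m, ⟨hm, hym⟩, -⟩ := hS.2 y hy
      have hpm : ¬ p ≤ m := fun hle =>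
        hyk ((hS.2 p hp).unique ⟨hm, hle⟩ ⟨hk, hpk⟩ ▸ hym)
      exact apply_eq_of_lineSpread hS hfix hy
        (apply_eq_of_lineSpread hS hfix hp hep hm hpm hy hym) hk hyk hz hzk
    · exact apply_eq_of_lineSpread hS hfix hp hep hk hpk hz hzk
  intro p hp
  refine ⟨hmove p hp, ?_⟩
  obtain ⟨L, ⟨hL, hpL⟩, -⟩ := hS.2 p hp
  rw [sup_eq_of_finrank_two (hS.1 L hL) hp (isAtom_orderIso e hp) (hmove p hp).symm hpL
    ((e.monotone hpL).trans (hfix L hL).le), hfix L hL]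

end Spreads

/-! ### Displacements of a collineation moving points along fixed lines -/

theorem MovesPointsAlongFixedLines.finrank_inf_apply_comm (hV : finrank K V = n + 1)
    {e : Submodule K V ≃o Submodule K V} (h : MovesPointsAlongFixedLines e)
    {U W : Submodule K V} (hUW : U ≤ W) : finrank K ↥(U ⊓ e W) = finrank K ↥(W ⊓ e U) := by
  have : FiniteDimensional K V := Module.finite_of_finrank_pos (by omega)
  have heq : U ⊓ e W = U ⊓ e.symm W := by
    refine eq_iff_atom_le_iff.2 fun p hp => ?_
    rw [le_inf_iff, le_inf_iff]
    refine and_congr_right fun hpU => ?_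
    rw [h.le_apply_iff hp (hpU.trans hUW), e.le_symm_apply]
  rw [heq, ← finrank_orderIso hV e, map_inf, e.apply_symm_apply, inf_comm]

/-- The dimension of `C i ∩ (C j)ᶿ` is symmetric in `i` and `j`. -/
theorem MovesPointsAlongFixedLines.weylDist_sq (hV : finrank K V = n + 1)
    {e : Submodule K V ≃o Submodule K V} (h : MovesPointsAlongFixedLines e) (C : Chamber K V n) :
    (C.weylDist hV ((Aut.collineation e).onChambers C)) ^ 2 = 1 := by
  have hinv : C.weylDist hV ((Aut.collineation e).onChambers C) =
      (C.weylDist hV ((Aut.collineation e).onChambers C))⁻¹ := by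
    rw [← Chamber.weylDist_swap]
    refine Chamber.weylDist_congr hV fun i j => ?_
    change finrank K ↥(C.space i ⊓ e (C.space j)) = finrank K ↥(e (C.space i) ⊓ C.space j)
    rw [inf_comm (e _)]
    rcases le_total i j with hij | hij
    · exact h.finrank_inf_apply_comm hV (C.strictMono.monotone hij)
    · exact (h.finrank_inf_apply_comm hV (C.strictMono.monotone hij)).symm
  rw [pow_two]
  nth_rewrite 1 [hinv]
  exact inv_mul_cancel _

/-- If `w k = k` there is a point of `C (k + 1) ∩ (C (k + 1))ᶿ` outside `(C k)ᶿ`. The fixed line on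
it meets `C k` in a point `y`, and `C k ∩ (C (k + 1))ᶿ ≤ (C k)ᶿ` puts `y` into `(C k)ᶿ`. So `yᶿ`
is in `C k`, hence the whole line is in `C k`, and being fixed, in `(C k)ᶿ`. -/
theorem MovesPointsAlongFixedLines.weylDist_apply_ne (hV : finrank K V = n + 1)
    {e : Submodule K V ≃o Submodule K V} (h : MovesPointsAlongFixedLines e) (C : Chamber K V n)
    (k : Fin (n + 1)) : C.weylDist hV ((Aut.collineation e).onChambers C) k ≠ k := by
  have : FiniteDimensional K V := Module.finite_of_finrank_pos (by omega)
  intro hk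
  have h1 := Chamber.weylDist_apply_lt_iff hV C ((Aut.collineation e).onChambers C) k k.succ
  have h2 := Chamber.weylDist_apply_lt_iff hV C ((Aut.collineation e).onChambers C) k k.castSucc
  rw [hk] at h1 h2
  simp only [Fin.val_succ, Nat.lt_succ_self, true_iff] at h1
  simp only [Fin.val_castSucc, lt_irrefl, false_iff, not_not] at h2
  change ¬ C.space k.succ ⊓ e (C.space k.succ) ≤ e (C.space k.castSucc) at h1
  change C.space k.castSucc ⊓ e (C.space k.succ) ≤ e (C.space k.castSucc) at h2
  obtain ⟨x, hx, hxle, hxn⟩ := exists_atom_le_not_le h1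
  rw [le_inf_iff] at hxle
  have hL : x ⊔ e x ≤ C.space k.succ := sup_le hxle.1 ((h.le_apply_iff hx hxle.1).1 hxle.2)
  obtain ⟨y, hy, hyL, hyC⟩ : ∃ y, IsAtom y ∧ y ≤ x ⊔ e x ∧ y ≤ C.space k.castSucc := by
    have hne : (x ⊔ e x) ⊓ C.space k.castSucc ≠ ⊥ := by
      intro hbot
      have h3 := Submodule.finrank_sup_add_finrank_inf_eq (x ⊔ e x) (C.space k.castSucc)
      have h4 := Submodule.finrank_mono
        (sup_le hL (C.strictMono.monotone k.castSucc_lt_succ.le))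
      rw [C.finrank_space hV] at h4
      rw [hbot, finrank_bot, h.finrank_join hx, C.finrank_space hV] at h3
      simp only [Fin.val_succ, Fin.val_castSucc] at h3 h4
      omega
    obtain ⟨y, hy, hyle⟩ := (eq_bot_or_exists_atom_le _).resolve_left hne
    exact ⟨y, hy, hyle.trans inf_le_left, hyle.trans inf_le_right⟩
  have hyD : y ≤ e (C.space k.castSucc) := by
    refine le_trans (le_inf hyC ?_) h2
    exact hyL.trans ((h x hx).2.ge.trans (e.monotone hL))
  have hLC : x ⊔ e x ≤ C.space k.castSucc := by
    rw [← h.join_eq hx hy hyL]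
    exact sup_le hyC ((h.le_apply_iff hy hyC).1 hyD)
  exact hxn (le_sup_left.trans ((h x hx).2.ge.trans (e.monotone hLC)))

/-! ### Collineations with displacements of constant sign -/

section ConstantSign

variable {hV : finrank K V = n + 1} {e : Submodule K V ≃o Submodule K V}

/-- Compare chambers with the same fixed line, one with the fixed point `r` and one with a moved
point `q`. -/
theorem apply_eq_of_fixed_line (hn : 2 ≤ n) (h : (Aut.collineation e).IsUniclass hV)
    {r q : Submodule K V} (hr : IsAtom r) (hq : IsAtom q) (her : e r = r)
    (hfix : e (r ⊔ q) = r ⊔ q) : e q = q := by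
  have : FiniteDimensional K V := Module.finite_of_finrank_pos (by omega)
  by_contra hne
  have hrq : r ≠ q := fun he => hne (he ▸ her)
  have heq := isAtom_orderIso e hq
  have hreq : r ≠ e q := fun he => hrq (e.injective (her.trans he))
  obtain ⟨C, C', hCC', h1, h2⟩ := exists_adjacent_chambers hn hV hr hq hrq
  set D := (Aut.collineation e).onChambers C with hD
  set D' := (Aut.collineation e).onChambers C' with hD'
  have hDi : ∀ i, D.space i = e (C.space i) := fun _ => rfl
  have hDi' : ∀ i, D'.space i = e (C'.space i) := fun _ => rfl
  have hsgn := h.sign_eq C C'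
  rw [← hD, ← hD'] at hsgn
  have s1 : Equiv.Perm.sign (C.weylDist hV D') = - Equiv.Perm.sign (C.weylDist hV D) := by
    refine Chamber.sign_weylDist_of_adjacent hn hV (fun i hi => ?_) (fun i hi => ?_)
      fun i a b ha hb hbot => ?_
    · rw [hDi, hDi', hCC' i hi]
    · rw [hDi, hDi', (h1 i hi).1, (h1 i hi).2, her]
      exact hreq.symm
    · rw [hDi, (h1 a ha).1, her, ← (h1 a ha).1]
      refine C.strictMono.monotone (Fin.le_def.2 ?_)
      by_contra hi
      exact hbot (by rw [C.space_eq_bot hV (by omega), bot_inf_eq])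
  have s2 : C.weylDist hV D' = C'.weylDist hV D' := by
    refine Chamber.weylDist_congr hV fun i j => ?_
    by_cases hi : (i : ℕ) = 1
    · rw [(h1 i hi).1, (h1 i hi).2]
      -- Neither `r` nor `q` is the point of `D'`, and all other members of `D'` contain the line.
      by_cases hj : (j : ℕ) = 0
      · rw [D'.space_eq_bot hV hj, inf_bot_eq, inf_bot_eq]
      by_cases hj1 : (j : ℕ) = 1
      · rw [hDi', (h1 j hj1).2,
          inf_eq_bot_of_atom_not_le hr fun hle => hreq (eq_of_atom_le_atom hr heq hle),
          inf_eq_bot_of_atom_not_le hq fun hle => hne (eq_of_atom_le_atom hq heq hle).symm]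
      · have hle : r ⊔ q ≤ D'.space j := by
          have e2 : D'.space ⟨2, by omega⟩ = r ⊔ q := by
            rw [hDi', hCC' _ (by simp), h2 _ rfl, hfix]
          rw [← e2]
          exact D'.strictMono.monotone (Fin.le_def.2 (show 2 ≤ (j : ℕ) by omega))
        rw [inf_eq_left.2 (le_sup_left.trans hle), inf_eq_left.2 (le_sup_right.trans hle),
          finrank_atom hr, finrank_atom hq]
    · rw [hCC' i hi]
  rw [hsgn, s2] at s1
  exact units_ne_neg_self _ s1

/-- If the line `p ⊔ e p` were moved, it would meet its image in the single point `e p`. Compare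
chambers on this line, one with the point `e p` and one with a third point `t`. -/
theorem apply_join_eq (hn : 2 ≤ n) (h : (Aut.collineation e).IsUniclass hV) {p : Submodule K V}
    (hp : IsAtom p) (hne : e p ≠ p) : e (p ⊔ e p) = p ⊔ e p := by
  have : FiniteDimensional K V := Module.finite_of_finrank_pos (by omega)
  by_contra hmove
  have hr := isAtom_orderIso e hp
  have herr : e (e p) ≠ e p := fun he => hne (e.injective he)
  have her := isAtom_orderIso e hr
  obtain ⟨t, ht, htp, htp', htr⟩ := exists_third_atom hp hr hne.symm
  have het := isAtom_orderIso e ht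
  have hℓ : e p ⊔ t = p ⊔ e p :=
    sup_eq_of_finrank_two (finrank_atom_sup_atom hp hr hne.symm) hr ht htr.symm le_sup_right htp
  have hℓ2 : finrank K ↥(e p ⊔ t) = 2 := finrank_atom_sup_atom hr ht htr.symm
  rw [← hℓ] at hmove
  have heℓ2 : finrank K ↥(e (e p ⊔ t)) = 2 := by rw [finrank_orderIso hV, hℓ2]
  have hrℓ : e p ≤ e p ⊔ t := le_sup_left
  have hreℓ : e p ≤ e (e p ⊔ t) := e.monotone (hℓ ▸ le_sup_left)
  have hnle : ¬ e p ⊔ t ≤ e (e p ⊔ t) := fun hle =>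
    hmove (Submodule.eq_of_le_of_finrank_eq hle (hℓ2.trans heℓ2.symm)).symm
  have hnle' : ¬ e (e p ⊔ t) ≤ e p ⊔ t := fun hle =>
    hmove (Submodule.eq_of_le_of_finrank_eq hle (heℓ2.trans hℓ2.symm))
  have hinf : (e p ⊔ t) ⊓ e (e p ⊔ t) = e p := inf_eq_atom_of_finrank_two hℓ2 hr hrℓ hreℓ hnle
  -- The images of the points other than `p` are not on the line.
  have hoff : ∀ x, IsAtom x → x ≤ e p ⊔ t → x ≠ p → ¬ e x ≤ e p ⊔ t := fun x hx hxℓ hxp hle =>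
    hxp (e.injective (eq_of_atom_le_atom (isAtom_orderIso e hx) hr
      (hinf ▸ le_inf hle (e.monotone hxℓ))))
  obtain ⟨C, C', hCC', h1, h2⟩ := exists_adjacent_chambers hn hV hr ht htr.symm
  set D := (Aut.collineation e).onChambers C with hD
  set D' := (Aut.collineation e).onChambers C' with hD'
  have hDi : ∀ i, D.space i = e (C.space i) := fun _ => rfl
  have hDi' : ∀ i, D'.space i = e (C'.space i) := fun _ => rfl
  have hsgn := h.sign_eq C C'
  rw [← hD, ← hD'] at hsgn
  -- The images of `e p` and `t` are both in general position to `C`.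
  have s1 : C.weylDist hV D = C.weylDist hV D' := by
    refine Chamber.weylDist_congr hV fun i j => ?_
    by_cases hj : (j : ℕ) = 1
    · rw [hDi, hDi', (h1 j hj).1, (h1 j hj).2]
      by_cases hi : (i : ℕ) ≤ 2
      · have hCi : C.space i ≤ e p ⊔ t := by
          rw [← h2 ⟨2, by omega⟩ rfl]
          exact C.strictMono.monotone (Fin.le_def.2 hi)
        rw [inf_comm, inf_comm (C.space i),
          inf_eq_bot_of_atom_not_le her fun hle =>
            hoff _ hr hrℓ hne (hle.trans hCi),
          inf_eq_bot_of_atom_not_le het fun hle =>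
            hoff _ ht le_sup_right htp' (hle.trans hCi)]
      · have hCi : e p ≤ C.space i := by
          refine hrℓ.trans ?_
          rw [← h2 ⟨2, by omega⟩ rfl]
          exact C.strictMono.monotone (Fin.le_def.2 (show 2 ≤ (i : ℕ) by omega))
        have hiff : e (e p) ≤ C.space i ↔ e t ≤ C.space i := by
          constructor
          · intro hle
            refine le_trans ?_ (sup_le hCi hle)
            rw [sup_eq_of_finrank_two heℓ2 hr her herr.symm hreℓ (e.monotone hrℓ)]
            exact e.monotone le_sup_right
          · intro hle
            refine le_trans ?_ (sup_le hCi hle)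
            rw [sup_eq_of_finrank_two heℓ2 hr het
              (fun he => htp' (e.injective he.symm)) hreℓ (e.monotone le_sup_right)]
            exact e.monotone hrℓ
        by_cases hle : e (e p) ≤ C.space i
        · rw [inf_eq_right.2 hle, inf_eq_right.2 (hiff.1 hle), finrank_atom her, finrank_atom het]
        · rw [inf_comm, inf_comm (C.space i), inf_eq_bot_of_atom_not_le her hle,
            inf_eq_bot_of_atom_not_le het (hiff.not.1 hle)]
    · rw [hDi, hDi', hCC' j hj]
  have s2 : Equiv.Perm.sign (D'.weylDist hV C') = - Equiv.Perm.sign (D'.weylDist hV C) := by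
    refine Chamber.sign_weylDist_of_adjacent hn hV hCC' (fun i hi => ?_)
      fun i a b ha hb hbot => ?_
    · rw [(h1 i hi).1, (h1 i hi).2]
      exact htr
    · rw [h2 b hb] at hbot
      rw [(h1 a ha).1]
      rcases Nat.lt_or_ge i 2 with hi | hi
      · -- The point of `D'` is off the line.
        refine absurd ?_ hbot
        by_cases hi0 : (i : ℕ) = 0
        · rw [D'.space_eq_bot hV hi0, bot_inf_eq]
        · rw [hDi', (h1 i (by omega)).2]
          exact inf_eq_bot_of_atom_not_le het (hoff t ht le_sup_right htp')
      · refine hreℓ.trans ?_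
        rw [← h2 ⟨2, by omega⟩ rfl, ← hCC' _ (by simp), ← hDi']
        exact D'.strictMono.monotone (Fin.le_def.2 hi)
  rw [Chamber.weylDist_swap, Chamber.weylDist_swap hV C, Equiv.Perm.sign_inv,
    Equiv.Perm.sign_inv, ← s1, hsgn] at s2
  exact units_ne_neg_self _ s2

/-- A uniclass collineation with a fixed point `r` and a moved point `p` would move a third point
`t` on the line `r ⊔ p`; the fixed lines `p ⊔ e p` and `t ⊔ e t` then meet in a fixed point, which
is impossible as `p` is moved. -/
theorem movesPointsAlongFixedLines_of_isUniclass (hn : 2 ≤ n)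
    (h : (Aut.collineation e).IsUniclass hV) (hne : (Aut.collineation e).onSubspaces ≠ 1) :
    MovesPointsAlongFixedLines e := by
  have : FiniteDimensional K V := Module.finite_of_finrank_pos (by omega)
  suffices hmove : ∀ r, IsAtom r → e r ≠ r from
    fun p hp => ⟨hmove p hp, apply_join_eq hn h hp (hmove p hp)⟩
  intro r hr her
  refine hne (collineation_onSubspaces_eq_one fun p hp => ?_)
  by_contra hep
  have hrp : r ≠ p := fun he => hep (he ▸ her)
  have hep' := isAtom_orderIso e hp
  have hℓ := apply_join_eq hn h hp hep
  have hℓ2 := finrank_atom_sup_atom hp hep' (Ne.symm hep)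
  -- A fixed line through `p` has no fixed points.
  have hnofix : ∀ s, IsAtom s → e s = s → ¬ s ≤ p ⊔ e p := by
    intro s hs hes hle
    have hsp : s ≠ p := fun he => hep (he ▸ hes)
    have hjoin := sup_eq_of_finrank_two hℓ2 hs hp hsp hle le_sup_left
    exact hep (apply_eq_of_fixed_line hn h hs hp hes (by rw [hjoin, hℓ]))
  have hrℓ := hnofix r hr her
  obtain ⟨t, ht, htrp, htr, htp⟩ := exists_third_atom hr hp hrp
  have hptr : p ≤ t ⊔ r := by
    rw [sup_comm] at htrp
    exact atom_exchange hp hr ht hrp.symm htr htrp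
  have hrtp : r ≤ t ⊔ p := atom_exchange hr hp ht hrp htp htrp
  have het : e t ≠ t := fun het => hep (by
    refine apply_eq_of_fixed_line hn h hr hp her ?_
    rw [← sup_eq_of_finrank_two (finrank_atom_sup_atom hr hp hrp) hr ht htr.symm le_sup_left htrp,
      map_sup, her, het])
  have hm := apply_join_eq hn h ht het
  have hm2 := finrank_atom_sup_atom ht (isAtom_orderIso e ht) het.symm
  have htℓ : ¬ t ≤ p ⊔ e p := fun hle => hrℓ (hrtp.trans (sup_le hle le_sup_left))
  -- Both fixed lines are in the plane `(p ⊔ e p) ⊔ r`, so they meet.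
  have hπ := finrank_sup_atom hr hrℓ
  have htπ : t ≤ (p ⊔ e p) ⊔ r := htrp.trans (sup_le le_sup_right (le_sup_left.trans le_sup_left))
  have hetπ : e t ≤ (p ⊔ e p) ⊔ r := by
    have := e.monotone htπ
    rwa [map_sup, hℓ, her] at this
  have h1 := Submodule.finrank_sup_add_finrank_inf_eq (t ⊔ e t) (p ⊔ e p)
  have h2 := Submodule.finrank_mono
    (sup_le (sup_le htπ hetπ) le_sup_left : (t ⊔ e t) ⊔ (p ⊔ e p) ≤ (p ⊔ e p) ⊔ r)
  have h3 : finrank K ↥((t ⊔ e t) ⊓ (p ⊔ e p)) < 2 := hm2 ▸ Submodule.finrank_lt_finrank_of_lt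
    (lt_of_le_of_ne inf_le_left fun he => htℓ (le_sup_left.trans (he ▸ inf_le_right)))
  have hs : IsAtom ((t ⊔ e t) ⊓ (p ⊔ e p)) :=
    Submodule.isAtom_iff_finrank_eq_one.2 (by omega)
  exact hnofix _ hs (by rw [map_inf, hm, hℓ]) inf_le_right

end ConstantSign

/-! ### Dualities and their absolute points -/

/-- The image of a subspace under a duality, as a subspace. -/
def dualImage (e : Submodule K V ≃o (Submodule K V)ᵒᵈ) (U : Submodule K V) : Submodule K V :=
  OrderDual.ofDual (e U)

section Dualities

variable {e : Submodule K V ≃o (Submodule K V)ᵒᵈ} {p q U W : Submodule K V}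

theorem dualImage_le_dualImage : dualImage e U ≤ dualImage e W ↔ W ≤ U :=
  e.le_iff_le (x := W) (y := U)

theorem dualImage_injective (e : Submodule K V ≃o (Submodule K V)ᵒᵈ) :
    Function.Injective (dualImage e) :=
  e.injective

theorem dualImage_sup (e : Submodule K V ≃o (Submodule K V)ᵒᵈ) (U W : Submodule K V) :
    dualImage e (U ⊔ W) = dualImage e U ⊓ dualImage e W :=
  e.map_sup U W

theorem isCoatom_dualImage (e : Submodule K V ≃o (Submodule K V)ᵒᵈ) (hp : IsAtom p) :
    IsCoatom (dualImage e p) :=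
  isAtom_dual_iff_isCoatom.1 ((e.isAtom_iff p).2 hp)

theorem isAtom_dualImage (e : Submodule K V ≃o (Submodule K V)ᵒᵈ) (hU : IsCoatom U) :
    IsAtom (dualImage e U) :=
  isCoatom_dual_iff_isAtom.1 ((e.isCoatom_iff U).2 hU)

theorem finrank_dualImage (hV : finrank K V = n + 1) (e : Submodule K V ≃o (Submodule K V)ᵒᵈ)
    (U : Submodule K V) : finrank K (dualImage e U) + finrank K U = n + 1 := by
  have : FiniteDimensional K V := Module.finite_of_finrank_pos (by omega)
  obtain ⟨C, hC, -⟩ := exists_chamber_through hV (le_refl U)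
  have hU := Submodule.finrank_le U
  let i : Fin (n + 2) := ⟨finrank K U, by omega⟩
  have h := ((Aut.duality e).onChambers C).finrank_space hV i.rev
  have h' : ((Aut.duality e).onChambers C).space i.rev = dualImage e U := by
    change dualImage e (C.space i.rev.rev) = _
    rw [Fin.rev_rev, hC i rfl]
  rw [h', Fin.val_rev] at h
  simp only [i] at h
  omega

/-- If every point is absolute, conjugacy of points is symmetric: otherwise a third point `t` of the
line `p ⊔ q` would have the same image as `p`, namely the span of the line and its image. -/
theorem le_dualImage_symm (hV : finrank K V = n + 1) (habs : ∀ p, IsAtom p → p ≤ dualImage e p)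
    (hp : IsAtom p) (hq : IsAtom q) (hqp : q ≤ dualImage e p) : p ≤ dualImage e q := by
  have : FiniteDimensional K V := Module.finite_of_finrank_pos (by omega)
  by_contra hpq
  have hne : p ≠ q := fun he => hpq (he ▸ habs p hp)
  obtain ⟨t, ht, htpq, htp, htq⟩ := exists_third_atom hp hq hne
  have hℓ2 := finrank_atom_sup_atom hp hq hne
  have hℓp : p ⊔ q ≤ dualImage e p := sup_le (habs p hp) hqp
  have hinf : (p ⊔ q) ⊓ dualImage e (p ⊔ q) = q := by
    refine inf_eq_atom_of_finrank_two hℓ2 hq le_sup_right ?_ fun hle => hpq ?_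
    · rw [dualImage_sup]; exact le_inf hqp (habs q hq)
    · rw [dualImage_sup] at hle
      exact le_sup_left.trans (hle.trans inf_le_right)
  have h1 := Submodule.finrank_sup_add_finrank_inf_eq (p ⊔ q) (dualImage e (p ⊔ q))
  have h2 := finrank_dualImage hV e (p ⊔ q)
  rw [hinf, finrank_atom hq] at h1
  have himg : ∀ s, IsAtom s → s ≤ p ⊔ q → p ⊔ q ≤ dualImage e s →
      (p ⊔ q) ⊔ dualImage e (p ⊔ q) = dualImage e s := by
    intro s hs hsℓ hℓs
    refine Submodule.eq_of_le_of_finrank_eq (sup_le hℓs (dualImage_le_dualImage.2 hsℓ)) ?_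
    have h3 := finrank_dualImage hV e s
    rw [finrank_atom hs] at h3
    omega
  have hℓt : p ⊔ q ≤ dualImage e t := by
    rw [← sup_eq_of_finrank_two hℓ2 ht hq htq htpq le_sup_right]
    refine sup_le (habs t ht) ?_
    exact hinf.ge.trans (inf_le_right.trans (dualImage_le_dualImage.2 htpq))
  exact htp (dualImage_injective e
    ((himg t ht htpq hℓt).symm.trans (himg p hp le_sup_left hℓp)))

theorem dualImage_dualImage (hV : finrank K V = n + 1)
    (habs : ∀ p, IsAtom p → p ≤ dualImage e p) (U : Submodule K V) :
    dualImage e (dualImage e U) = U := by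
  have : FiniteDimensional K V := Module.finite_of_finrank_pos (by omega)
  -- If `p = e W`, then the points `q` of `W` satisfy `p ≤ e q`, hence `q ≤ e p` by symmetry.
  have hatom : ∀ p, IsAtom p → dualImage e (dualImage e p) = p := by
    intro p hp
    obtain ⟨W, hW⟩ := e.surjective (OrderDual.toDual p)
    have hW : dualImage e W = p := hW
    have hle : W ≤ dualImage e p := le_iff_atom_le_imp.2 fun q hq hqW =>
      le_dualImage_symm hV habs hq hp (hW ▸ dualImage_le_dualImage.2 hqW)
    refine eq_of_atom_le_atom (isAtom_dualImage e (isCoatom_dualImage e hp)) hp ?_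
    exact (dualImage_le_dualImage.2 hle).trans hW.le
  refine eq_iff_atom_le_iff.2 fun p hp => ?_
  conv_lhs => rw [← hatom p hp, dualImage_le_dualImage, dualImage_le_dualImage]

theorem isSymplecticPolarity_of_forall_le_dualImage (hV : finrank K V = n + 1)
    (habs : ∀ p, IsAtom p → p ≤ dualImage e p) (hne : (Aut.duality e).onSubspaces ≠ 1) :
    (Aut.duality e).IsSymplecticPolarity := by
  refine ⟨⟨e, rfl⟩, orderOf_eq_prime ?_ hne, habs⟩
  rw [pow_two]
  exact Equiv.ext fun U => dualImage_dualImage hV habs U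

theorem Aut.IsSymplecticPolarity.le_dualImage (h : (Aut.duality e).IsSymplecticPolarity)
    (hp : IsAtom p) : p ≤ dualImage e p :=
  h.2.2 p hp

theorem Aut.IsSymplecticPolarity.dualImage_dualImage (h : (Aut.duality e).IsSymplecticPolarity)
    (U : Submodule K V) : dualImage e (dualImage e U) = U := by
  have h2 := pow_orderOf_eq_one (Aut.duality e).onSubspaces
  rw [h.2.1, pow_two] at h2
  exact congrArg (fun σ : Equiv.Perm (Submodule K V) => σ U) h2

/-- A flag `(p, H)` is mapped to `(p', H')` with `p ≤ H'` and `p' ≤ H`, and `p = p'` exactly if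
`H = H'`. -/
theorem Aut.IsSymplecticPolarity.isPolarKangaroo (hn : 2 ≤ n) (hV : finrank K V = n + 1)
    (h : (Aut.duality e).IsSymplecticPolarity) :
    (Aut.duality e).IsPolarKangaroo {.one, .twoPrime, .three} := by
  intro x
  let y := (Aut.duality e).onFlags x
  have hy1 : y.point = dualImage e x.hyperplane := rfl
  have hy2 : y.hyperplane = dualImage e x.point := rfl
  have h1 : x.point ≤ y.hyperplane := h.le_dualImage x.isAtom
  have h2 : y.point ≤ x.hyperplane := by
    have := h.le_dualImage y.isAtom
    rwa [hy1, h.dualImage_dualImage] at this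
  have h12 := (not_inPosition_one_twoPrime_iff hn hV (x := x) (y := y)).2 ⟨⟨fun he => by
    rw [hy2, he, hy1, h.dualImage_dualImage], fun he => by
    rw [hy1, he, hy2, h.dualImage_dualImage]⟩, iff_of_true h1 h2⟩
  rintro d (hd | hd | hd)
  · exact h12 d (Or.inl hd)
  · exact h12 d (Or.inr hd)
  · rw [hd]
    exact not_inPosition_three hn hV h1

/-- For a flag `(p, H)`, a kangaroo has `p ≤ e p` exactly if `e H ≤ H`; as any two points lie in a
common hyperplane, either all points are absolute or none is. -/
theorem forall_or_forall_not_le_dualImage_of_isPolarKangaroo (hn : 2 ≤ n)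
    (hV : finrank K V = n + 1) (h : (Aut.duality e).IsPolarKangaroo {.one, .twoPrime}) :
    (∀ p, IsAtom p → p ≤ dualImage e p) ∨ ∀ p, IsAtom p → ¬ p ≤ dualImage e p := by
  have : FiniteDimensional K V := Module.finite_of_finrank_pos (by omega)
  rw [Aut.isPolarKangaroo_one_twoPrime_iff hn hV] at h
  have hflag : ∀ {p H : Submodule K V}, IsAtom p → IsCoatom H → p ≤ H →
      (p ≤ dualImage e p ↔ dualImage e H ≤ H) := fun hp hH hle => (h ⟨_, _, hp, hH, hle⟩).2
  by_contra! hcon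
  obtain ⟨⟨q, hq, hqn⟩, p, hp, hpa⟩ := hcon
  have hne : p ⊔ q ≠ ⊤ := fun htop => by
    have h1 := Submodule.finrank_add_le_finrank_add_finrank p q
    rw [htop, finrank_top, finrank_atom hp, finrank_atom hq] at h1
    omega
  obtain ⟨H, hH, hle⟩ := (eq_top_or_exists_le_coatom (p ⊔ q)).resolve_left hne
  exact hqn ((hflag hq hH (le_sup_right.trans hle)).2
    ((hflag hp hH (le_sup_left.trans hle)).1 hpa))

/-- Without absolute points every subspace is complementary to its image. -/
theorem isAnisotropic_of_forall_not_le_dualImage (hV : finrank K V = n + 1)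
    (hnone : ∀ p, IsAtom p → ¬ p ≤ dualImage e p) : (Aut.duality e).IsAnisotropic hV := by
  have : FiniteDimensional K V := Module.finite_of_finrank_pos (by omega)
  have hdis : ∀ U, U ⊓ dualImage e U = ⊥ := by
    intro U
    by_contra hne
    obtain ⟨p, hp, hle⟩ := (eq_bot_or_exists_atom_le _).resolve_left hne
    rw [le_inf_iff] at hle
    exact hnone p hp (hle.2.trans (dualImage_le_dualImage.2 hle.1))
  intro C
  refine Chamber.weylDist_eq_of_finrank hV fun i j => ?_
  rw [cornerCount_revPerm (by omega) (by omega)]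
  change finrank K ↥(C.space i ⊓ dualImage e (C.space j.rev)) = _
  have hj := finrank_dualImage hV e (C.space j.rev)
  have hjr := C.finrank_space hV j.rev
  have hi := C.finrank_space hV i
  rw [Fin.val_rev] at hjr
  rcases le_total i j.rev with hij | hij
  · have h1 : C.space i ⊓ dualImage e (C.space j.rev) = ⊥ :=
      le_bot_iff.1 (hdis (C.space j.rev) ▸ inf_le_inf_right _ (C.strictMono.monotone hij))
    rw [Fin.le_def, Fin.val_rev] at hij
    rw [h1, finrank_bot]
    omega
  · have h1 := Submodule.finrank_sup_add_finrank_inf_eq (C.space i) (dualImage e (C.space j.rev))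
    have h2 := Submodule.finrank_sup_add_finrank_inf_eq (C.space j.rev)
      (dualImage e (C.space j.rev))
    rw [hdis, finrank_bot] at h2
    have h3 := Submodule.finrank_mono (sup_le_sup_right (C.strictMono.monotone hij)
      (dualImage e (C.space j.rev)))
    have h4 := Submodule.finrank_le (C.space i ⊔ dualImage e (C.space j.rev))
    rw [Fin.le_def, Fin.val_rev] at hij
    omega

/-! ### Dualities with displacements of constant sign -/

/-- If `r` is absolute, `q` is not, and `q` were not on the image of `r`, then chambers on the line
`r ⊔ q` with the points `r` and `q` would have displacements of different sign. -/
theorem le_dualImage_of_isUniclass (hn : 2 ≤ n) {hV : finrank K V = n + 1}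
    (h : (Aut.duality e).IsUniclass hV) {r q : Submodule K V} (hr : IsAtom r) (hq : IsAtom q)
    (hra : r ≤ dualImage e r) (hqn : ¬ q ≤ dualImage e q) : q ≤ dualImage e r := by
  have : FiniteDimensional K V := Module.finite_of_finrank_pos (by omega)
  by_contra hqr
  have hrq : r ≠ q := fun he => hqn (he ▸ hra)
  obtain ⟨C, C', hCC', h1, h2⟩ := exists_adjacent_chambers hn hV hr hq hrq
  set D := (Aut.duality e).onChambers C with hD
  set D' := (Aut.duality e).onChambers C' with hD'
  have hDi : ∀ i, D.space i = dualImage e (C.space i.rev) := fun _ => rfl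
  have hDi' : ∀ i, D'.space i = dualImage e (C'.space i.rev) := fun _ => rfl
  have hsgn := h.sign_eq C C'
  rw [← hD, ← hD'] at hsgn
  have hℓ2 := finrank_atom_sup_atom hr hq hrq
  have s1 : Equiv.Perm.sign (D.weylDist hV C') = - Equiv.Perm.sign (D.weylDist hV C) := by
    refine Chamber.sign_weylDist_of_adjacent hn hV hCC' (fun i hi => ?_)
      fun j a b ha hb hbot => ?_
    · rw [(h1 i hi).1, (h1 i hi).2]
      exact hrq.symm
    · rw [h2 b hb] at hbot
      rw [(h1 a ha).1]
      by_cases hj : (j : ℕ) = n + 1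
      · rw [D.space_eq_top hV hj]
        exact le_top
      · have hjD : D.space j ≤ dualImage e r := by
          rw [hDi, ← (h1 ⟨1, by omega⟩ rfl).1, dualImage_le_dualImage]
          refine C.strictMono.monotone (Fin.le_def.2 ?_)
          rw [Fin.val_rev]
          show 1 ≤ _
          omega
        -- The line meets the hyperplane `e r` in `r` only.
        have hle : D.space j ⊓ (r ⊔ q) ≤ r :=
          (le_inf inf_le_right (inf_le_left.trans hjD)).trans_eq
            (inf_eq_atom_of_finrank_two hℓ2 hr le_sup_left hra
              fun hle => hqr (le_sup_right.trans hle))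
        exact ((hr.le_iff.1 hle).resolve_left hbot) ▸ inf_le_left
  have s2 : C'.weylDist hV D = C'.weylDist hV D' := by
    refine Chamber.weylDist_congr hV fun i j => ?_
    by_cases hj : (j.rev : ℕ) = 1
    · rw [hDi, hDi', (h1 _ hj).1, (h1 _ hj).2]
      by_cases hi : (i : ℕ) = 0
      · rw [C'.space_eq_bot hV hi, bot_inf_eq, bot_inf_eq]
      · have hqC : q ≤ C'.space i := by
          rw [← (h1 ⟨1, by omega⟩ rfl).2]
          exact C'.strictMono.monotone (Fin.le_def.2 (Nat.pos_of_ne_zero hi))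
        have h3 := finrank_inf_coatom (isCoatom_dualImage e hr) fun hle => hqr (hqC.trans hle)
        have h4 := finrank_inf_coatom (isCoatom_dualImage e hq) fun hle => hqn (hqC.trans hle)
        omega
    · rw [hDi, hDi', hCC' _ hj]
  rw [Chamber.weylDist_swap, Chamber.weylDist_swap hV C, Equiv.Perm.sign_inv,
    Equiv.Perm.sign_inv, s2, hsgn] at s1
  exact units_ne_neg_self _ s1

/-- If `p` is absolute and `q` is not, all points outside the hyperplane `e p` are absolute. A line
through `q` and such a point contains two of them, whose images, hence also `e q`, contain `q`. -/
theorem forall_or_forall_not_le_dualImage_of_isUniclass (hn : 2 ≤ n) {hV : finrank K V = n + 1}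
    (h : (Aut.duality e).IsUniclass hV) :
    (∀ p, IsAtom p → p ≤ dualImage e p) ∨ ∀ p, IsAtom p → ¬ p ≤ dualImage e p := by
  have : FiniteDimensional K V := Module.finite_of_finrank_pos (by omega)
  by_contra! hcon
  obtain ⟨⟨q, hq, hqn⟩, p, hp, hpa⟩ := hcon
  have hqp := le_dualImage_of_isUniclass hn h hp hq hpa hqn
  have habs : ∀ x, IsAtom x → ¬ x ≤ dualImage e p → q ≤ dualImage e x := by
    intro x hx hxp
    refine le_dualImage_of_isUniclass hn h hx hq ?_ hqn
    by_contra hxn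
    exact hxp (le_dualImage_of_isUniclass hn h hp hx hpa hxn)
  obtain ⟨x, hx, -, hxp⟩ := exists_atom_le_not_le fun hle =>
    (isCoatom_dualImage e hp).1 (top_le_iff.1 hle)
  have hxq : x ≠ q := fun he => hxp (he ▸ hqp)
  obtain ⟨t, ht, htxq, htx, htq⟩ := exists_third_atom hx hq hxq
  have hxtq : x ≤ t ⊔ q := atom_exchange hx hq ht hxq htq htxq
  have htp : ¬ t ≤ dualImage e p := fun hle => hxp (hxtq.trans (sup_le hle hqp))
  refine hqn ((le_inf (habs x hx hxp) (habs t ht htp)).trans ?_)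
  rw [← dualImage_sup, dualImage_le_dualImage,
    sup_eq_of_finrank_two (finrank_atom_sup_atom hx hq hxq) hx ht htx.symm le_sup_left htxq]
  exact le_sup_right

/-! ### Displacements of a symplectic polarity -/

theorem Aut.IsSymplecticPolarity.finrank_inf_dualImage (hV : finrank K V = n + 1)
    (h : (Aut.duality e).IsSymplecticPolarity) (U W : Submodule K V) :
    finrank K ↥(U ⊓ dualImage e W) + finrank K W =
      finrank K ↥(W ⊓ dualImage e U) + finrank K U := by
  have : FiniteDimensional K V := Module.finite_of_finrank_pos (by omega)
  have h1 := Submodule.finrank_sup_add_finrank_inf_eq U (dualImage e W)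
  have h2 := finrank_dualImage hV e W
  have h3 := finrank_dualImage hV e (U ⊔ dualImage e W)
  rw [dualImage_sup, h.dualImage_dualImage, inf_comm] at h3
  omega

/-- The relation between `C i ∩ (C m)ᶿ` and `C m ∩ (C i)ᶿ` says that the displacement `w` equals
`w₀ w⁻¹ w₀`. -/
theorem Aut.IsSymplecticPolarity.weylDist_mul_revPerm_sq (hV : finrank K V = n + 1)
    (h : (Aut.duality e).IsSymplecticPolarity) (C : Chamber K V n) :
    (C.weylDist hV ((Aut.duality e).onChambers C) * Fin.revPerm) ^ 2 = 1 := by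
  set w := C.weylDist hV ((Aut.duality e).onChambers C) with hw
  have hsymm : w = Fin.revPerm * w⁻¹ * Fin.revPerm := by
    refine Chamber.weylDist_eq_of_finrank hV fun i j => ?_
    have h1 := cornerCount_revPerm_mul_inv_mul_revPerm w (i := i) (j := j) (by omega) (by omega)
    have h2 := Chamber.finrank_inf_eq_cornerCount hV C ((Aut.duality e).onChambers C) j.rev i.rev
    have h3 : finrank K ↥(C.space j.rev ⊓ dualImage e (C.space i.rev.rev)) =
      cornerCount w j.rev i.rev := h2
    have h4 := h.finrank_inf_dualImage hV (C.space i) (C.space j.rev)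
    rw [C.finrank_space hV, C.finrank_space hV, Fin.val_rev] at h4
    rw [Fin.rev_rev, Fin.val_rev, Fin.val_rev, show n + 2 - (j + 1) = n + 1 - j by omega,
      show n + 2 - (i + 1) = n + 1 - i by omega] at h3
    change finrank K ↥(C.space i ⊓ dualImage e (C.space j.rev)) = _
    omega
  have hrev : (Fin.revPerm : Equiv.Perm (Fin (n + 1))) * Fin.revPerm = 1 :=
    Equiv.ext fun k => Fin.rev_rev k
  calc (w * Fin.revPerm) ^ 2 = w * Fin.revPerm * (w * Fin.revPerm) := pow_two _
    _ = w * Fin.revPerm * ((Fin.revPerm * w⁻¹ * Fin.revPerm) * Fin.revPerm) := by rw [← hsymm]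
    _ = w * (Fin.revPerm * Fin.revPerm) * w⁻¹ * (Fin.revPerm * Fin.revPerm) := by group
    _ = 1 := by rw [hrev]; group

/-- A fixed point `m` gives a point `x` of `C (m + 1) ∩ (C m)ᶿ` outside `(C (m + 1))ᶿ`. Then
`C (m + 1)` is spanned by `C m` and `x`, so its image is `(C m)ᶿ ∩ xᶿ`, which contains `x`. -/
theorem Aut.IsSymplecticPolarity.weylDist_mul_revPerm_apply_ne (hV : finrank K V = n + 1)
    (h : (Aut.duality e).IsSymplecticPolarity) (C : Chamber K V n) (m : Fin (n + 1)) :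
    (C.weylDist hV ((Aut.duality e).onChambers C) * Fin.revPerm :
      Equiv.Perm (Fin (n + 1))) m ≠ m := by
  have : FiniteDimensional K V := Module.finite_of_finrank_pos (by omega)
  intro hm
  rw [Equiv.Perm.mul_apply, Fin.revPerm_apply] at hm
  have h1 := Chamber.weylDist_apply_lt_iff hV C ((Aut.duality e).onChambers C) m.rev m.succ
  have h2 := Chamber.weylDist_apply_lt_iff hV C ((Aut.duality e).onChambers C) m.rev m.castSucc
  rw [hm] at h1 h2
  simp only [Fin.val_succ, Nat.lt_succ_self, true_iff] at h1
  simp only [Fin.val_castSucc, lt_irrefl, false_iff, not_not] at h2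
  have e1 : ((Aut.duality e).onChambers C).space m.rev.succ = dualImage e (C.space m.castSucc) := by
    change dualImage e (C.space m.rev.succ.rev) = _
    rw [Fin.rev_succ, Fin.rev_rev]
  have e2 : ((Aut.duality e).onChambers C).space m.rev.castSucc = dualImage e (C.space m.succ) := by
    change dualImage e (C.space m.rev.castSucc.rev) = _
    rw [Fin.rev_castSucc, Fin.rev_rev]
  rw [e1, e2] at h1 h2
  obtain ⟨x, hx, hxle, hxn⟩ := exists_atom_le_not_le h1
  rw [le_inf_iff] at hxle
  have hxC : ¬ x ≤ C.space m.castSucc := fun hle => hxn ((le_inf hle hxle.2).trans h2)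
  have hsup : C.space m.castSucc ⊔ x = C.space m.succ := by
    refine Submodule.eq_of_le_of_finrank_eq
      (sup_le (C.strictMono.monotone m.castSucc_lt_succ.le) hxle.1) ?_
    rw [finrank_sup_atom hx hxC, C.finrank_space hV, C.finrank_space hV]
    simp
  refine hxn ?_
  rw [← hsup, dualImage_sup]
  exact le_inf hxle.2 (h.le_dualImage hx)

end Dualities

/-! ### The classification -/

namespace Aut

variable {hV : finrank K V = n + 1} {θ : Aut K V}

theorem isUniclass_of_forall_exists (h : ∀ C C' : Chamber K V n, ∃ g,
    C'.weylDist hV (θ.onChambers C') =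
      g⁻¹ * C.weylDist hV (θ.onChambers C) * θ.companion n g) : θ.IsUniclass hV := by
  rcases isEmpty_or_nonempty (Chamber K V n) with hC | ⟨⟨C⟩⟩
  · exact ⟨1, fun _ ⟨C, _⟩ => hC.elim C⟩
  · refine ⟨C.weylDist hV (θ.onChambers C), ?_⟩
    rintro _ ⟨C', rfl⟩
    exact h C C'

theorem IsAnisotropic.isUniclass (h : θ.IsAnisotropic hV) : θ.IsUniclass hV :=
  isUniclass_of_forall_exists fun C C' => ⟨1, by rw [h C, h C']; simp⟩

theorem isUniclass_of_movesPointsAlongFixedLines {e : Submodule K V ≃o Submodule K V}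
    (h : MovesPointsAlongFixedLines e) : (Aut.collineation e).IsUniclass hV := by
  refine isUniclass_of_forall_exists fun C C' => ?_
  obtain ⟨c, hc⟩ := isConj_iff.1 (isConj_of_fixedPointFree_involutions (h.weylDist_sq hV C)
    (h.weylDist_sq hV C') (h.weylDist_apply_ne hV C) (h.weylDist_apply_ne hV C'))
  exact ⟨c⁻¹, by rw [← hc, inv_inv]; rfl⟩

theorem IsSymplecticPolarity.isUniclass {e : Submodule K V ≃o (Submodule K V)ᵒᵈ}
    (h : (Aut.duality e).IsSymplecticPolarity) : (Aut.duality e).IsUniclass hV := by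
  refine isUniclass_of_forall_exists fun C C' => ?_
  obtain ⟨c, hc⟩ := isConj_iff.1 (isConj_of_fixedPointFree_involutions
    (h.weylDist_mul_revPerm_sq hV C) (h.weylDist_mul_revPerm_sq hV C')
    (h.weylDist_mul_revPerm_apply_ne hV C) (h.weylDist_mul_revPerm_apply_ne hV C'))
  refine ⟨c⁻¹, ?_⟩
  rw [companion, MulAut.conj_apply, inv_inv]
  calc _ = (C'.weylDist hV ((Aut.duality e).onChambers C') * Fin.revPerm) * Fin.revPerm⁻¹ := by
        group
    _ = _ := by rw [← hc]; group

end Aut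

/-- Neither points nor hyperplanes are fixed, and the point of a flag `(p, H)` lies in `e H` exactly
if its image lies in `H`. -/
theorem MovesPointsAlongFixedLines.isPolarKangaroo (hn : 2 ≤ n) (hV : finrank K V = n + 1)
    {e : Submodule K V ≃o Submodule K V} (h : MovesPointsAlongFixedLines e) :
    (Aut.collineation e).IsPolarKangaroo {.zero, .one, .twoPrime} := by
  have : FiniteDimensional K V := Module.finite_of_finrank_pos (by omega)
  intro x
  have h1 : x.point ≠ e x.point := (h _ x.isAtom).1.symm
  have h2 : x.hyperplane ≠ e x.hyperplane := (h.apply_hyperplane_ne x.isCoatom).symm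
  have h12 := (not_inPosition_one_twoPrime_iff hn hV (x := x)
    (y := (Aut.collineation e).onFlags x)).2
    ⟨iff_of_false h1 h2, h.le_apply_iff x.isAtom x.le⟩
  rintro d (hd | hd | hd)
  · rw [hd]
    exact fun he => h1 (congrArg PointHyperplaneFlag.point he)
  · exact h12 d (Or.inl hd)
  · exact h12 d (Or.inr hd)

/-- If a point is fixed, so are all hyperplanes through it, and then all points of these. -/
theorem movesPointsAlongFixedLines_of_isPolarKangaroo (hn : 2 ≤ n) (hV : finrank K V = n + 1)
    {e : Submodule K V ≃o Submodule K V}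
    (h : (Aut.collineation e).IsPolarKangaroo {.one, .twoPrime})
    (hne : (Aut.collineation e).onSubspaces ≠ 1) : MovesPointsAlongFixedLines e := by
  have : FiniteDimensional K V := Module.finite_of_finrank_pos (by omega)
  rw [Aut.isPolarKangaroo_one_twoPrime_iff hn hV] at h
  have h1 : ∀ {p H : Submodule K V}, IsAtom p → IsCoatom H → p ≤ H → (p = e p ↔ H = e H) :=
    fun hp hH hle => (h ⟨_, _, hp, hH, hle⟩).1
  have h2 : ∀ {p H : Submodule K V}, IsAtom p → IsCoatom H → p ≤ H → (p ≤ e H ↔ e p ≤ H) :=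
    fun hp hH hle => (h ⟨_, _, hp, hH, hle⟩).2
  have hmove : ∀ p, IsAtom p → e p ≠ p := by
    intro p hp hep
    refine hne (collineation_onSubspaces_eq_one fun q hq => ?_)
    have htop : p ⊔ q ≠ ⊤ := fun htop => by
      have h3 := Submodule.finrank_add_le_finrank_add_finrank p q
      rw [htop, finrank_top, finrank_atom hp, finrank_atom hq] at h3
      omega
    obtain ⟨H, hH, hle⟩ := (eq_top_or_exists_le_coatom (p ⊔ q)).resolve_left htop
    exact ((h1 hq hH (le_sup_right.trans hle)).2
      ((h1 hp hH (le_sup_left.trans hle)).1 hep.symm)).symm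
  intro p hp
  have hep := isAtom_orderIso e hp
  refine ⟨hmove p hp, ?_⟩
  -- Every hyperplane through `p` and `e p` contains `e (e p)`.
  have hle : e (e p) ≤ p ⊔ e p := le_of_forall_coatom fun H hH hH' =>
    (h2 hep hH (le_sup_right.trans hH')).1 (e.monotone (le_sup_left.trans hH'))
  rw [map_sup]
  exact Submodule.eq_of_le_of_finrank_eq (sup_le le_sup_right hle) (by
    rw [← map_sup, finrank_orderIso hV])

end ProjectiveGeometry

theorem mainTheorem5 {K V : Type*} [DivisionRing K] [AddCommGroup V] [Module K V]
    (n : ℕ) (hn : 2 ≤ n) (hV : Module.finrank K V = n + 1)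
    (θ : ProjectiveGeometry.Aut K V) (hθ : θ.onSubspaces ≠ 1) :
    (θ.IsPolarKangaroo {.one, .twoPrime} ↔
      θ.IsAnisotropic hV ∨ θ.IsSymplecticPolarity ∨ θ.IsCollineationFixingLineSpread) ∧
    (θ.IsSymplecticPolarity → θ.IsPolarKangaroo {.one, .twoPrime, .three}) ∧
    (θ.IsCollineationFixingLineSpread → θ.IsPolarKangaroo {.zero, .one, .twoPrime}) ∧
    (θ.IsPolarKangaroo {.one, .twoPrime} ↔ θ.IsUniclass hV) := by
  open ProjectiveGeometry in
  have : FiniteDimensional K V := Module.finite_of_finrank_pos (by omega)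
  have hmono : ∀ {D D' : Set PointLineGeometry.Position}, D' ⊆ D → θ.IsPolarKangaroo D →
      θ.IsPolarKangaroo D' := fun hD h x d hd => h x d (hD hd)
  have hsympl : θ.IsSymplecticPolarity → θ.IsPolarKangaroo {.one, .twoPrime, .three} := by
    intro h
    obtain ⟨e, rfl⟩ := h.1
    exact h.isPolarKangaroo hn hV
  have hmoves : θ.IsCollineationFixingLineSpread →
      ∃ e, θ = .collineation e ∧ MovesPointsAlongFixedLines e := by
    rintro ⟨⟨e, rfl⟩, S, hS, hfix⟩
    exact ⟨e, rfl, movesPointsAlongFixedLines_of_lineSpread hn hV hS hfix hθ⟩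
  have hspread : θ.IsCollineationFixingLineSpread →
      θ.IsPolarKangaroo {.zero, .one, .twoPrime} := by
    intro h
    obtain ⟨e, rfl, he⟩ := hmoves h
    exact he.isPolarKangaroo hn hV
  have hkangaroo : θ.IsPolarKangaroo {.one, .twoPrime} →
      θ.IsAnisotropic hV ∨ θ.IsSymplecticPolarity ∨ θ.IsCollineationFixingLineSpread := by
    intro h
    cases θ with
    | collineation e =>
      exact Or.inr (Or.inr (movesPointsAlongFixedLines_of_isPolarKangaroo hn hV h
        hθ).isCollineationFixingLineSpread)
    | duality e =>
      rcases forall_or_forall_not_le_dualImage_of_isPolarKangaroo hn hV h with habs | hnone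
      · exact Or.inr (Or.inl (isSymplecticPolarity_of_forall_le_dualImage hV habs hθ))
      · exact Or.inl (isAnisotropic_of_forall_not_le_dualImage hV hnone)
  have hkangaroo' :
      (θ.IsAnisotropic hV ∨ θ.IsSymplecticPolarity ∨ θ.IsCollineationFixingLineSpread) →
      θ.IsPolarKangaroo {.one, .twoPrime} := by
    rintro (h | h | h)
    · exact h.isPolarKangaroo hn
    · refine hmono ?_ (hsympl h)
      rintro d (hd | hd)
      exacts [Or.inl hd, Or.inr (Or.inl hd)]
    · exact hmono (Set.subset_insert _ _) (hspread h)
  refine ⟨⟨hkangaroo, hkangaroo'⟩, hsympl, hspread, fun h => ?_, fun h => hkangaroo' ?_⟩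
  · rcases hkangaroo h with h | h | h
    · exact h.isUniclass
    · obtain ⟨e, rfl⟩ := h.1
      exact h.isUniclass
    · obtain ⟨e, rfl, he⟩ := hmoves h
      exact Aut.isUniclass_of_movesPointsAlongFixedLines he
  · cases θ with
    | collineation e =>
      exact Or.inr (Or.inr
        (movesPointsAlongFixedLines_of_isUniclass hn h hθ).isCollineationFixingLineSpread)
    | duality e =>
      rcases forall_or_forall_not_le_dualImage_of_isUniclass hn h with habs | hnone
      · exact Or.inr (Or.inl (isSymplecticPolarity_of_forall_le_dualImage hV habs hθ))
      · exact Or.inl (isAnisotropic_of_forall_not_le_dualImage hV hnone)
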